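/- All graphs are finite and simple. For a tree $T$ let $d_T(v)$ be the degree of $v$, let $SO(T)=\sum_{uv\in E(T)}\sqrt{d_T(u)^2+d_T(v)^2}$ be its Sombor index, and let the degree sequence of $T$ be the list of the degrees of its non-leaf vertices (vertices of degree other than $1$) in non-increasing order. Let $L_1(T)$ be the set of vertices adjacent to a leaf, $d^m(T)=\min\{d_T(u):u\in L_1(T)\}$, and let $L_1^m(T)$ be the set of leaves whose neighbour has degree $d^m(T)$. Let $m\ge 1$ and $D=(d_1,\dots,d_m)$ with $d_1\ge d_2\ge\cdots\ge d_m\ge 2$. Algorithm 1 produces from $D$ a list of rooted trees $T_1,\dots,T_k$ as follows. If $d_m\ge m-1$, then $k=1$ and $T_1$ is the tree whose root has $d_m$ children, namely vertices of degrees $d_1,\dots,d_{m-1}$ (all of whose other neighbours are leaves) and $d_m-m+1$ leaves. If $d_m\le m-2$, then $T_1$ is the tree whose root has exactly $d_m-1$ children, of degrees $d_1,\dots,d_{d_m-1}$ (all of whose other neighbours are leaves), and $T_2,\dots,T_k$ is the list produced by Algorithm 1 from the remaining sequence $(d_{d_m},d_{d_m+1},\dots,d_{m-1})$. Algorithm 2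 starts with $T'_k=T_k$ and, for $i=k-1,k-2,\dots,1$, lets $T'_i$ be the graph obtained from the disjoint union of $T'_{i+1}$ and $T_i$ by identifying the root of $T_i$ with some vertex of $L_1^m(T'_{i+1})$, chosen arbitrarily. Then the algorithms can be carried out, and for every choice made in Algorithm 2 the resulting graph $T'_1$ is a tree with degree sequence $D$ that maximizes the Sombor index among all trees with degree sequence $D$. -/

import Mathlib

namespace SomborTrees

/-! ### Finite graphs, degree sequences and the Sombor index -/

section Basic

open Classical in
/-- The Sombor index: the sum over the edges `uv` of `√(d(u)² + d(v)²)`. -/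
noncomputable def sombor {V : Type} [Fintype V] (G : SimpleGraph V) : ℝ :=
  ∑ e ∈ G.edgeFinset,
    Sym2.lift ⟨fun u v : V => Real.sqrt ((G.degree u : ℝ) ^ 2 + (G.degree v : ℝ) ^ 2),
      fun u v => by simp only [add_comm]⟩ e

open Classical in
/-- The degree sequence: the degrees of the non-leaf vertices (those of degree different from 1),
with multiplicity, arranged in non-increasing order. -/
noncomputable def degreeSequence {V : Type} [Fintype V] (G : SimpleGraph V) : List ℕ :=
  (((Finset.univ.filter fun v : V => G.degree v ≠ 1).val.map fun v => G.degree v)).sort (· ≥ ·)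

open Classical in
/-- The set of leaves. -/
def leaves {V : Type} [Fintype V] (G : SimpleGraph V) : Set V :=
  {v | G.degree v = 1}

/-- The set `L₁` of vertices adjacent to a leaf. -/
def leafNeighbors {V : Type} [Fintype V] (G : SimpleGraph V) : Set V :=
  {u | ∃ v ∈ leaves G, G.Adj u v}

open Classical in
/-- `d^m = min {d(u) : u ∈ L₁}`. -/
noncomputable def minLeafNeighborDegree {V : Type} [Fintype V] (G : SimpleGraph V) : ℕ :=
  sInf ((fun u => G.degree u) '' leafNeighbors G)

open Classical in
/-- The set `L₁^m` of leaves whose neighbour has degree `d^m`. -/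
def minLeaves {V : Type} [Fintype V] (G : SimpleGraph V) : Set V :=
  {v | v ∈ leaves G ∧ ∃ u, G.Adj v u ∧ G.degree u = minLeafNeighborDegree G}

/-- `G` is a maximum optimal tree for `D`: it is a tree with degree sequence `D`, and it has the
largest Sombor index among all finite trees with degree sequence `D`. -/
def IsMaximumOptimalTree (D : List ℕ) {V : Type} [Fintype V] (G : SimpleGraph V) : Prop :=
  G.IsTree ∧ degreeSequence G = D ∧
    ∀ (W : Type) [Fintype W] (H : SimpleGraph W),
      H.IsTree → degreeSequence H = D → sombor H ≤ sombor G

end Basic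

/-! ### The construction -/

/-- A finite graph together with its vertex type. -/
structure FiniteGraph where
  V : Type
  fintypeV : Fintype V
  graph : SimpleGraph V

attribute [instance] FiniteGraph.fintypeV

/-- A finite graph with a distinguished vertex. -/
structure RootedGraph extends FiniteGraph where
  root : V

/-- Vertices of the rooted tree of height at most two whose root has one child of degree `c` for
every entry `c` of `cs`, and `l` further children that are leaves: `none` is the root,
`some (inl (inl i))` is the child number `i`, `some (inl (inr j))` is the leaf number `j` at the
root, and `some (inr ⟨i, p⟩)` is the leaf number `p` at child `i`. -/
abbrev SubtreeVertex (cs : List ℕ) (l : ℕ) : Type :=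
  Option ((Fin cs.length ⊕ Fin l) ⊕ (Σ i : Fin cs.length, Fin (cs.get i - 1)))

/-- `x` is the parent of `y`. -/
def IsParent (cs : List ℕ) (l : ℕ) (x y : SubtreeVertex cs l) : Prop :=
  match x, y with
  | none, some (Sum.inl _) => True
  | some (Sum.inl (Sum.inl i)), some (Sum.inr p) => p.1 = i
  | _, _ => False

/-- The rooted tree whose root has children of degrees `cs` (a child of degree `c` has `c - 1`
leaves attached to it) and, in addition, `l` leaves. -/
def rootedSubtree (cs : List ℕ) (l : ℕ) : RootedGraph where
  V := SubtreeVertex cs l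
  fintypeV := inferInstance
  graph := SimpleGraph.fromRel (IsParent cs l)
  root := none

/-- Construction of subtrees (Algorithm 1): the list `T₁, …, T_k` of rooted trees produced from
`D = (d₁, …, d_m)`. If `d_m ≥ m - 1`, the only tree has a root with `d_m` children, of degrees
`d₁, …, d_{m-1}` and `d_m - m + 1` times `1`. If `d_m ≤ m - 2`, the first tree has a root with
`d_m - 1` children, of degrees `d₁, …, d_{d_m - 1}`, and the procedure continues with
`(d_{d_m}, …, d_{m-1})`. -/
def algorithmOne (D : List ℕ) : List RootedGraph :=
  if D.length ≤ D.getLastD 0 + 1 then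
    [rootedSubtree D.dropLast (D.getLastD 0 + 1 - D.length)]
  else
    rootedSubtree (D.take (D.getLastD 0 - 1)) 0 ::
      algorithmOne (D.dropLast.drop (D.getLastD 0 - 1))
termination_by D.length
decreasing_by
  simp only [List.length_drop, List.length_dropLast]
  omega

/-- Adjacency in the merged graph, before symmetrization: the vertices of `S` other than its root
are kept, and the root of `S` has become the vertex `v` of `T`. -/
def MergeRel (T : FiniteGraph) (v : T.V) (S : RootedGraph)
    (x y : T.V ⊕ {w : S.V // w ≠ S.root}) : Prop :=
  match x, y with
  | Sum.inl a, Sum.inl b => T.graph.Adj a b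
  | Sum.inr a, Sum.inr b => S.graph.Adj a.1 b.1
  | Sum.inl a, Sum.inr b => a = v ∧ S.graph.Adj S.root b.1
  | Sum.inr _, Sum.inl _ => False

open Classical in
/-- The graph obtained from the disjoint union of `T` and `S` by identifying the root of `S` with
the vertex `v` of `T`. -/
noncomputable def merge (T : FiniteGraph) (v : T.V) (S : RootedGraph) : FiniteGraph where
  V := T.V ⊕ {w : S.V // w ≠ S.root}
  fintypeV := inferInstance
  graph := SimpleGraph.fromRel (MergeRel T v S)

/-- Merge of subtrees (Algorithm 2): `AlgorithmTwo [T₁, …, T_k] T` says that `T` is a possible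
final tree `T'₁` when one starts with `T_k` and then, for `i = k - 1, …, 1`, identifies the root of
`T_i` with some vertex of `L₁^m` of the current tree. All choices of that vertex are allowed. -/
inductive AlgorithmTwo : List RootedGraph → FiniteGraph → Prop
  | start (S : RootedGraph) : AlgorithmTwo [S] S.toFiniteGraph
  | step (S : RootedGraph) (Ss : List RootedGraph) (T : FiniteGraph) (v : T.V) :
      AlgorithmTwo Ss T → v ∈ minLeaves T.graph → AlgorithmTwo (S :: Ss) (merge T v S)

end SomborTrees

namespace SomborTrees

open SimpleGraph

/-! ### Sums over edges -/

/-! The proof is an induction along Algorithm 1 of a statement stronger than optimality. Cutting a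
tree at a vertex makes that vertex a leaf of one piece, yet its remaining edge must still be weighed
with the old degree. Vertices therefore carry labels: the degree at a non-leaf, and at a leaf any
number not exceeding the entries of `D`. `Dominates` is the resulting claim for labelled trees;
labelling by the degree itself gives the theorem.

By concavity of the square root, pairing large labels with small ones increases the weight
(`sqrt_add_sqrt_le`). Exchanging two branches of a tree thus shows that a heaviest tree with
prescribed degrees, ties being broken by an injective ranking, is alternating
(`exists_isAlternating`). Let `u` be its non-leaf of least rank; its degree `d` is the last entry.
If there are at most `d` other non-leaves, they are all neighbours of `u`, and the tree is the base
case of Algorithm 1. Otherwise `u` has no leaf neighbour, exactly one neighbour of `u` is not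
pendant, and the other `d - 1` neighbours outrank all remaining non-leaves, so they have the `d - 1`
largest degrees. These neighbours with `u` form the first tree of Algorithm 1. Cutting it off leaves
a smaller tree in which `u` is a leaf labelled `d`, and the induction hypothesis applies.

The induction places `u` at some leaf of the constructed tree, perhaps not the one chosen in
Algorithm 2. But `d` is the largest leaf label, and a leaf of `L₁^m` has a neighbour of least
degree, so swapping the two leaf positions loses no weight (`edgeSum_le_edgeSum_swap`). This is why
the choice is arbitrary. -/

/-- The sum of `φ` over the edges of `G`. -/
noncomputable def edgeSum {V M : Type} [AddCommMonoid M] (G : SimpleGraph V) (φ : Sym2 V → M) : M :=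
  ∑ᶠ e ∈ G.edgeSet, φ e

/-- The degree of a vertex, as the cardinality of its set of neighbours. -/
noncomputable def deg {V : Type} (G : SimpleGraph V) (v : V) : ℕ := (G.neighborSet v).ncard

theorem degree_eq_deg {V : Type} (G : SimpleGraph V) (v : V) [Fintype (G.neighborSet v)] :
    G.degree v = deg G v := by
  rw [deg, Set.ncard_eq_toFinset_card', ← G.card_neighborFinset_eq_degree]
  rfl

/-- The weight `√(l(u)² + l(v)²)` of an edge `uv` whose ends are labelled by `l`. -/
noncomputable def weight {V : Type} (l : V → ℕ) : Sym2 V → ℝ :=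
  Sym2.lift ⟨fun u v => Real.sqrt ((l u : ℝ) ^ 2 + (l v : ℝ) ^ 2),
    fun u v => by simp only [add_comm]⟩

theorem weight_mk {V : Type} (l : V → ℕ) (u v : V) :
    weight l s(u, v) = Real.sqrt ((l u : ℝ) ^ 2 + (l v : ℝ) ^ 2) := rfl

theorem weight_map {V W : Type} (l : W → ℕ) (f : V → W) (e : Sym2 V) :
    weight l (e.map f) = weight (l ∘ f) e := by
  induction e with | _ u v => rfl

theorem sombor_eq_edgeSum {V : Type} [Fintype V] (G : SimpleGraph V) :
    sombor G = edgeSum G (weight (deg G)) := by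
  classical
  rw [sombor, edgeSum, ← coe_edgeFinset, finsum_mem_coe_finset]
  refine Finset.sum_congr rfl fun e _ => ?_
  induction e with | _ u v => simp only [Sym2.lift_mk, weight_mk, degree_eq_deg]

-- With degrees written as edge sums, one identity valid for all edge sums controls the number of
-- edges, the degrees and the weight simultaneously.
open Classical in
theorem deg_eq_edgeSum {V : Type} [Finite V] (G : SimpleGraph V) (v : V) :
    deg G v = edgeSum G fun e => if v ∈ e then 1 else 0 := by
  have := Fintype.ofFinite V
  rw [← degree_eq_deg, ← card_incidenceFinset_eq_degree, edgeSum, ← coe_edgeFinset,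
    finsum_mem_coe_finset, ← Finset.sum_filter, incidenceFinset_eq_filter, Finset.card_eq_sum_ones]

theorem ncard_edgeSet_eq_edgeSum {V : Type} [Finite V] (G : SimpleGraph V) :
    G.edgeSet.ncard = edgeSum G fun _ => 1 := by
  classical
  have := Fintype.ofFinite V
  rw [edgeSum, ← coe_edgeFinset, finsum_mem_coe_finset, Set.ncard_coe_finset,
    Finset.card_eq_sum_ones]

theorem isTree_iff_connected_and_edgeSum {V : Type} [Finite V] (G : SimpleGraph V) :
    G.IsTree ↔ G.Connected ∧ (edgeSum G fun _ => 1) + 1 = Nat.card V := by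
  rw [isTree_iff_connected_and_card, ← ncard_edgeSet_eq_edgeSum]
  rfl

theorem edgeSum_map {V W M : Type} [AddCommMonoid M] (f : V ↪ W) (G : SimpleGraph V)
    (φ : Sym2 W → M) : edgeSum (G.map f) φ = edgeSum G fun e => φ (e.map f) := by
  rw [edgeSum, edgeSet_map, finsum_mem_image]
  · rfl
  · exact (Sym2.map.injective f.injective).injOn

theorem edgeSum_sup {V M : Type} [Finite V] [AddCommMonoid M] {G H : SimpleGraph V}
    (h : Disjoint G H) (φ : Sym2 V → M) : edgeSum (G ⊔ H) φ = edgeSum G φ + edgeSum H φ := by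
  rw [edgeSum, edgeSet_sup, finsum_mem_union _ (Set.toFinite _) (Set.toFinite _)]
  · rfl
  · rwa [disjoint_edgeSet]

/-! ### Exchanging two edges -/

theorem connected_of_adj_reachable {V : Type} {G H : SimpleGraph V} (hG : G.Connected)
    (h : ∀ x y, G.Adj x y → H.Reachable x y) : H.Connected := by
  have := hG.nonempty
  refine ⟨fun x y => ?_⟩
  obtain ⟨p⟩ := hG.preconnected x y
  induction p with
  | nil => rfl
  | cons hadj _ ih => exact (h _ _ hadj).trans ih

/-- Such an edge would be a second path from `a` to `y`, besides `p` followed by the edge `by`. -/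
theorem not_adj_of_isPath {V : Type} {G : SimpleGraph V} (hG : G.IsAcyclic) {a b y : V}
    {p : G.Walk a b} (hp : p.IsPath) (hab : a ≠ b) (hby : G.Adj b y) (hy : y ∉ p.support) :
    ¬ G.Adj a y := by
  intro h
  have := congrArg (fun q : G.Path a y => q.1.length)
    ((hG.subsingleton_path a y).elim ⟨_, hp.concat hy hby⟩ (Path.singleton h))
  simp only [Walk.length_concat, Path.singleton_coe, Walk.length_cons, Walk.length_nil] at this
  exact hab (Walk.eq_of_length_eq_zero (p := p) (by omega))

/-- The edges `ax`, `by` are replaced by `ay`, `bx`. The path from `a` to `b` avoids `x` and `y`, so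
it survives and reconnects the ends of both deleted edges; the edge count is unchanged. The identity
ranges over all monoids because it is used for edge counts, degrees, weights and ranks. -/
theorem exists_isTree_swap {V : Type} [Finite V] {G : SimpleGraph V} (hG : G.IsTree) {a b x y : V}
    {p : G.Walk a b} (hp : p.IsPath) (hab : a ≠ b) (hax : G.Adj a x) (hby : G.Adj b y)
    (hx : x ∉ p.support) (hy : y ∉ p.support) :
    ∃ H : SimpleGraph V, H.IsTree ∧ ∀ (M : Type) [AddCommMonoid M] (φ : Sym2 V → M),
      edgeSum H φ + (φ s(a, x) + φ s(b, y)) = edgeSum G φ + (φ s(a, y) + φ s(b, x)) := by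
  have hay : ¬ G.Adj a y := not_adj_of_isPath hG.isAcyclic hp hab hby hy
  have hbx : ¬ G.Adj b x :=
    not_adj_of_isPath hG.isAcyclic hp.reverse hab.symm hax (by simpa using hx)
  have hya : y ≠ a := by rintro rfl; exact hy p.start_mem_support
  have hyb := hby.ne'
  have hxa := hax.ne'
  have hxb : x ≠ b := by rintro rfl; exact hx p.end_mem_support
  have hxy : x ≠ y := by rintro rfl; exact hay hax
  set R : Set (Sym2 V) := G.edgeSet \ {s(a, x), s(b, y)} with hR
  set E : Set (Sym2 V) := {s(a, y), s(b, x)} with hE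
  have hdis : Disjoint R E := by
    rw [Set.disjoint_left]
    rintro e ⟨he, -⟩ (rfl | rfl)
    · exact hay he
    · exact hbx he
  have hedge : (fromEdgeSet (R ∪ E)).edgeSet = R ∪ E := by
    rw [edgeSet_fromEdgeSet, sdiff_eq_left, Set.disjoint_left]
    rintro e (⟨he, -⟩ | rfl | rfl)
    · exact G.not_isDiag_of_mem_edgeSet he
    · simpa using hya.symm
    · simpa using hxb.symm
  have hsum : ∀ (M : Type) [AddCommMonoid M] (φ : Sym2 V → M),
      edgeSum (fromEdgeSet (R ∪ E)) φ + (φ s(a, x) + φ s(b, y)) =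
        edgeSum G φ + (φ s(a, y) + φ s(b, x)) := by
    intro M _ φ
    have h1 : s(a, x) ≠ s(b, y) := by simp [hab, hya.symm]
    have h2 : s(a, y) ≠ s(b, x) := by simp [hab, hxa.symm]
    have h3 : edgeSum G φ = (φ s(a, x) + φ s(b, y)) + ∑ᶠ e ∈ R, φ e := by
      rw [edgeSum, ← finsum_mem_pair h1, finsum_mem_add_sdiff _ (Set.toFinite _)]
      rintro e (rfl | rfl)
      · exact hax
      · exact hby
    rw [h3, edgeSum, hedge, finsum_mem_union hdis (Set.toFinite _) (Set.toFinite _),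
      finsum_mem_pair h2]
    abel
  refine ⟨fromEdgeSet (R ∪ E), ?_, hsum⟩
  rw [isTree_iff_connected_and_edgeSum] at hG ⊢
  refine ⟨?_, by have := hsum ℕ fun _ => 1; omega⟩
  have hkeep : ∀ {u v}, G.Adj u v → s(u, v) ≠ s(a, x) → s(u, v) ≠ s(b, y) →
      (fromEdgeSet (R ∪ E)).Adj u v := by
    intro u v h h1 h2
    rw [fromEdgeSet_adj]
    exact ⟨Or.inl ⟨h, by simp only [Set.mem_insert_iff, Set.mem_singleton_iff]; tauto⟩, h.ne⟩
  have hpath : (fromEdgeSet (R ∪ E)).Reachable a b := by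
    refine ⟨p.transfer _ fun e he => ?_⟩
    induction e with | _ u v =>
    refine hkeep (p.adj_of_mem_edges he) ?_ ?_
    · intro h
      rw [h] at he
      exact hx (p.snd_mem_support_of_mem_edges he)
    · intro h
      rw [h] at he
      exact hy (p.snd_mem_support_of_mem_edges he)
  have hay' : (fromEdgeSet (R ∪ E)).Adj a y := by
    rw [fromEdgeSet_adj]; exact ⟨Or.inr (Or.inl rfl), hya.symm⟩
  have hbx' : (fromEdgeSet (R ∪ E)).Adj b x := by
    rw [fromEdgeSet_adj]; exact ⟨Or.inr (Or.inr rfl), hxb.symm⟩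
  have hrax := hpath.trans hbx'.reachable
  have hrby := hpath.symm.trans hay'.reachable
  refine connected_of_adj_reachable hG.1 fun u v h => ?_
  by_cases h1 : s(u, v) = s(a, x)
  · rcases Sym2.eq_iff.1 h1 with ⟨rfl, rfl⟩ | ⟨rfl, rfl⟩
    · exact hrax
    · exact hrax.symm
  by_cases h2 : s(u, v) = s(b, y)
  · rcases Sym2.eq_iff.1 h2 with ⟨rfl, rfl⟩ | ⟨rfl, rfl⟩
    · exact hrby
    · exact hrby.symm
  exact (hkeep h h1 h2).reachable

/-! ### Alternating trees -/

/-- With capitals for squares, both sides have radicands of the same sum, while the products of the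
radicands differ by `(A - B)(X - Y) ≥ 0`. Comparing the squares of the two sides finishes. -/
theorem sqrt_add_sqrt_le {a b x y : ℕ} (hab : b ≤ a) (hyx : y ≤ x) :
    √((a : ℝ) ^ 2 + (x : ℝ) ^ 2) + √((b : ℝ) ^ 2 + (y : ℝ) ^ 2) ≤
      √((a : ℝ) ^ 2 + (y : ℝ) ^ 2) + √((b : ℝ) ^ 2 + (x : ℝ) ^ 2) := by
  have h1 : (b : ℝ) ^ 2 ≤ (a : ℝ) ^ 2 := by gcongr
  have h2 : (y : ℝ) ^ 2 ≤ (x : ℝ) ^ 2 := by gcongr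
  have hb : (0 : ℝ) ≤ (b : ℝ) ^ 2 := by positivity
  have hy : (0 : ℝ) ≤ (y : ℝ) ^ 2 := by positivity
  generalize (a : ℝ) ^ 2 = A at *
  generalize (b : ℝ) ^ 2 = B at *
  generalize (x : ℝ) ^ 2 = X at *
  generalize (y : ℝ) ^ 2 = Y at *
  have hp : √(A + X) * √(B + Y) ≤ √(A + Y) * √(B + X) := by
    rw [← Real.sqrt_mul (by linarith), ← Real.sqrt_mul (by linarith)]
    apply Real.sqrt_le_sqrt
    nlinarith [mul_nonneg (sub_nonneg.2 h1) (sub_nonneg.2 h2)]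
  refine le_of_sq_le_sq ?_ (by positivity)
  have e1 := Real.sq_sqrt (show 0 ≤ A + X by linarith)
  have e2 := Real.sq_sqrt (show 0 ≤ B + Y by linarith)
  have e3 := Real.sq_sqrt (show 0 ≤ A + Y by linarith)
  have e4 := Real.sq_sqrt (show 0 ≤ B + X by linarith)
  nlinarith

/-- No exchange of two pendant branches strictly decreases the alternation of `G` with respect to
the ranking `r`: if `a` outranks `b`, then the branches at `b` (those not on the path from `a` to
`b`) start with vertices that outrank the first vertices of the branches at `a`. -/
def IsAlternating {V : Type} (G : SimpleGraph V) (r : V → ℕ) : Prop :=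
  ∀ (a b x y : V) (p : G.Walk a b), p.IsPath → G.Adj a x → G.Adj b y → x ∉ p.support →
    y ∉ p.support → r b < r a → r x < r y

/-- The negated product of the ranks of the ends of an edge. -/
def negRankProd {V : Type} (r : V → ℕ) : Sym2 V → ℤ :=
  Sym2.lift ⟨fun u v => -((r u : ℤ) * r v), fun u v => by simp only [mul_comm]⟩

/-- A lexicographic maximum of weight and then of negated rank products works: a violating pair of
branches could be exchanged without losing weight while strictly increasing the second coordinate.
-/
theorem exists_isAlternating {V : Type} [Finite V] {G : SimpleGraph V} (hG : G.IsTree)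
    (l r : V → ℕ) (hr : Function.Injective r) (hlr : ∀ x y, r x < r y → l x ≤ l y) :
    ∃ H : SimpleGraph V, H.IsTree ∧ (∀ v, deg H v = deg G v) ∧
      edgeSum G (weight l) ≤ edgeSum H (weight l) ∧ IsAlternating H r := by
  classical
  obtain ⟨H, ⟨hH, hHdeg⟩, hmax⟩ := Set.exists_max_image
    {H : SimpleGraph V | H.IsTree ∧ ∀ v, deg H v = deg G v}
    (fun H => toLex (edgeSum H (weight l), edgeSum H (negRankProd r))) (Set.toFinite _)
    ⟨G, hG, fun _ => rfl⟩
  refine ⟨H, hH, hHdeg, ?_, ?_⟩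
  · have := Prod.Lex.le_iff.1 (hmax G ⟨hG, fun _ => rfl⟩)
    rcases this with h | h
    · exact h.le
    · exact h.1.le
  intro a b x y p hp hax hby hx hy hba
  by_contra hxy
  have hne : a ≠ b := by rintro rfl; exact lt_irrefl _ hba
  have hyx : r y < r x := by
    -- Equal ranks would mean `x = y`, adjacent to both `a` and `b` off the path between them, which
    -- closes a cycle.
    refine lt_of_le_of_ne (not_lt.1 hxy) fun h => ?_
    rw [hr h] at hby hy
    exact not_adj_of_isPath hH.isAcyclic hp hne hby hx hax
  obtain ⟨K, hK, hsum⟩ := exists_isTree_swap hH hp hne hax hby hx hy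
  have hKdeg : ∀ v, deg K v = deg G v := by
    intro v
    rw [← hHdeg, deg_eq_edgeSum, deg_eq_edgeSum]
    have := hsum ℕ fun e => if v ∈ e then 1 else 0
    have h1 := hax.ne
    have h2 := hby.ne
    have h3 : a ≠ y := by rintro rfl; exact hy p.start_mem_support
    have h4 : b ≠ x := by rintro rfl; exact hx p.end_mem_support
    have h5 : ∀ c d : V, c ≠ d → (if v ∈ s(c, d) then 1 else 0) =
        (if v = c then 1 else 0) + (if v = d then 1 else 0) := by
      intro c d hcd
      by_cases hc : v = c <;> by_cases hd : v = d <;> simp_all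
    rw [h5 _ _ h1, h5 _ _ h2, h5 _ _ h3, h5 _ _ h4] at this
    omega
  have hle := Prod.Lex.le_iff.1 (hmax K ⟨hK, hKdeg⟩)
  have hw := hsum ℝ (weight l)
  have hn := hsum ℤ (negRankProd r)
  have hs := sqrt_add_sqrt_le (hlr _ _ hba) (hlr _ _ hyx)
  simp only [weight_mk] at hw
  simp only [negRankProd, Sym2.lift_mk] at hn
  -- This product is exactly the gain in the second coordinate.
  have hprod : (0 : ℤ) < ((r a : ℤ) - r b) * ((r x : ℤ) - r y) := by
    apply mul_pos <;> omega
  change edgeSum K (weight l) < edgeSum H (weight l) ∨ edgeSum K (weight l) = edgeSum H (weight l) ∧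
    edgeSum K (negRankProd r) ≤ edgeSum H (negRankProd r) at hle
  rcases hle with h | ⟨-, h⟩
  · linarith
  · unfold negRankProd at h
    nlinarith

theorem exists_injective_rank {V : Type} [Finite V] (κ : V → ℕ) :
    ∃ r : V → ℕ, Function.Injective r ∧ ∀ x y, κ x < κ y → r x < r y := by
  obtain ⟨n, ⟨e⟩⟩ := Finite.exists_equiv_fin V
  -- The index `e v < n` breaks ties and is recovered modulo `n`.
  refine ⟨fun v => κ v * n + e v, fun x y h => ?_, fun x y h => ?_⟩
  · have := congrArg (· % n) h
    exact e.injective (Fin.ext (by simpa [Nat.mul_add_mod, Nat.mod_eq_of_lt] using this))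
  · have := (e x).2
    have : (κ x + 1) * n ≤ κ y * n := Nat.mul_le_mul_right _ h
    simp only
    nlinarith

/-! ### The structure of alternating trees -/

theorem eq_of_deg_eq_one {V : Type} {G : SimpleGraph V} {v x y : V} (hv : deg G v = 1)
    (hx : G.Adj v x) (hy : G.Adj v y) : x = y := by
  obtain ⟨a, ha⟩ := Set.ncard_eq_one.1 hv
  have h1 : x ∈ G.neighborSet v := hx
  have h2 : y ∈ G.neighborSet v := hy
  rw [ha] at h1 h2
  exact h1.trans h2.symm

theorem exists_adj_of_two_le_deg {V : Type} [Finite V] {G : SimpleGraph V} {v : V}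
    (hv : 2 ≤ deg G v) (c : V) : ∃ y, G.Adj v y ∧ y ≠ c :=
  Set.exists_ne_of_one_lt_ncard hv c

theorem deg_ne_one_of_mem_support {V : Type} {G : SimpleGraph V} {u z w : V} {p : G.Walk u z}
    (hp : p.IsPath) (hw : w ∈ p.support) (hu : w ≠ u) (hz : w ≠ z) : deg G w ≠ 1 := by
  intro h
  obtain ⟨p₀, p₁, -, -, rfl⟩ := hp.mem_support_iff_exists_append.1 hw
  have n0 : ¬ p₀.Nil := Walk.not_nil_of_ne hu.symm
  have n1 : ¬ p₁.Nil := Walk.not_nil_of_ne hz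
  have h0 := Walk.adj_penultimate n0
  have h1 := Walk.adj_snd n1
  exact hp.ne_of_mem_support_of_append h1.ne' (Walk.getVert_mem_support _ _)
    (Walk.getVert_mem_support _ _) (eq_of_deg_eq_one h h0.symm h1)

/-- All neighbours of `q` other than `c` are leaves. -/
def IsPendant {V : Type} (G : SimpleGraph V) (q c : V) : Prop :=
  ∀ x, G.Adj q x → x ≠ c → deg G x = 1

/-- `G` is a tree that alternates with respect to a ranking in which the leaves come first and are
followed by the vertex `u`. -/
structure IsCanonical {V : Type} (G : SimpleGraph V) (r : V → ℕ) (u : V) : Prop where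
  isTree : G.IsTree
  alternating : IsAlternating G r
  injective : Function.Injective r
  two_le_deg : ∀ v, deg G v ≠ 1 → 2 ≤ deg G v
  leaf_lt : ∀ x y, deg G x = 1 → deg G y ≠ 1 → r x < r y
  deg_ne_one : deg G u ≠ 1
  lt_of_ne : ∀ z, deg G z ≠ 1 → z ≠ u → r u < r z

namespace IsCanonical

variable {V : Type} {G : SimpleGraph V} {r : V → ℕ} {u : V}

/-- Since `a` outranks `b`, alternation puts every branch of `a` off the path below the leaf `y`;
only leaves rank below a leaf. -/
theorem isPendant_snd (h : IsCanonical G r u) {a b y : V} (ha : deg G a ≠ 1) (hby : G.Adj b y)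
    (hy : deg G y = 1) (hba : r b < r a) {p : G.Walk a b} (hp : p.IsPath) :
    IsPendant G a p.snd := by
  intro x hax hx
  by_contra hx1
  refine lt_asymm (h.leaf_lt y x hy hx1) (h.alternating a b x y p hp hax hby ?_ ?_ hba)
  · exact fun hmem => hx (h.isTree.isAcyclic.eq_snd_of_adj_start hp hax hmem)
  · exact fun hmem => deg_ne_one_of_mem_support hp hmem
      (by rintro rfl; exact ha hy) hby.ne' hy

/-- A path continuing past `q` would step to a leaf, where it can neither go on nor end. -/
theorem eq_of_isPendant {q z : V} (hq : IsPendant G q u)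
    (hz : deg G z ≠ 1) {p : G.Walk u z} (hp : p.IsPath) (hmem : q ∈ p.support) : q = z := by
  by_contra hne
  obtain ⟨p₀, p₁, hp₀, hp₁, rfl⟩ := hp.mem_support_iff_exists_append.1 hmem
  have n1 : ¬ p₁.Nil := Walk.not_nil_of_ne hne
  have h1 := Walk.adj_snd n1
  have hsu : p₁.snd ≠ u := fun hs => hp.ne_of_mem_support_of_append (x := u) (y := p₁.snd)
    h1.ne' p₀.start_mem_support (Walk.getVert_mem_support _ _) hs.symm
  have hleaf := hq _ h1 hsu
  exact deg_ne_one_of_mem_support hp₁ (Walk.getVert_mem_support _ _) h1.ne'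
    (fun hs => hz (hs ▸ hleaf)) hleaf

/-- If the path from `z` to `u` had an interior vertex after `z`, that vertex would outrank `u`, and
the leaf at `u` would force its neighbour `z` to be a leaf. -/
theorem adj_of_adj_leaf (h : IsCanonical G r u) {y : V} (huy : G.Adj u y) (hy : deg G y = 1)
    {z : V} (hz : deg G z ≠ 1) (hzu : z ≠ u) : G.Adj u z := by
  obtain ⟨p, hp, -⟩ := h.isTree.existsUnique_path z u
  have n := Walk.not_nil_of_ne (p := p) hzu
  have h1 := Walk.adj_snd n
  by_cases hs : p.snd = u
  · rw [hs] at h1; exact h1.symm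
  have hs1 : deg G p.snd ≠ 1 :=
    deg_ne_one_of_mem_support hp (Walk.getVert_mem_support _ _) h1.ne' hs
  have := h.isPendant_snd hs1 huy hy (h.lt_of_ne _ hs1 hs) hp.tail z h1.symm ?_
  · exact absurd this hz
  · intro he
    have h2 := hp
    rw [← Walk.cons_tail_eq p n, Walk.cons_isPath_iff] at h2
    apply h2.2
    have : p.tail.snd ∈ p.tail.support := Walk.getVert_mem_support _ _
    rwa [← he] at this

theorem isPendant_of_forall_adj (h : IsCanonical G r u)
    (hadj : ∀ z, deg G z ≠ 1 → z ≠ u → G.Adj u z) {z : V} (hz : deg G z ≠ 1) (hzu : z ≠ u) :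
    IsPendant G z u := by
  intro x hzx hxu
  by_contra hx
  have huz := hadj z hz hzu
  refine not_adj_of_isPath h.isTree.isAcyclic (p := huz.toWalk) ?_ hzu.symm hzx ?_ (hadj x hx hxu)
  · simpa using huz.ne
  · simpa using ⟨hxu, hzx.ne'⟩

/-- Either `u` has a leaf neighbour, which settles the claim, or its neighbours are non-leaves and
numerous enough to be all the others. -/
theorem adj_of_card_le [Finite V] (h : IsCanonical G r u)
    (hcard : {v | deg G v ≠ 1}.ncard ≤ deg G u + 1) {z : V} (hz : deg G z ≠ 1) (hzu : z ≠ u) :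
    G.Adj u z := by
  by_cases hleaf : ∃ y, G.Adj u y ∧ deg G y = 1
  · obtain ⟨y, huy, hy⟩ := hleaf
    exact h.adj_of_adj_leaf huy hy hz hzu
  push Not at hleaf
  have hsub : G.neighborSet u ⊆ {v | deg G v ≠ 1} \ {u} := fun y hy => ⟨hleaf y hy, hy.ne'⟩
  have := Set.ncard_sdiff_singleton_add_one (s := {v | deg G v ≠ 1}) (a := u) h.deg_ne_one
  have heq := Set.eq_of_subset_of_ncard_le hsub
    (by have hd : deg G u = (G.neighborSet u).ncard := rfl; omega)
  have : z ∈ G.neighborSet u := heq ▸ ⟨hz, hzu⟩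
  exact this

theorem deg_ne_one_of_adj [Finite V] (h : IsCanonical G r u)
    (hcard : deg G u + 2 ≤ {v | deg G v ≠ 1}.ncard) {q : V} (huq : G.Adj u q) :
    deg G q ≠ 1 := by
  intro hq
  have hsub : {v | deg G v ≠ 1} \ {u} ⊆ G.neighborSet u := fun z hz =>
    h.adj_of_adj_leaf huq hq hz.1 hz.2
  have h1 := Set.ncard_le_ncard hsub
  have := Set.ncard_sdiff_singleton_add_one (s := {v | deg G v ≠ 1}) (a := u) h.deg_ne_one
  have hd : deg G u = (G.neighborSet u).ncard := rfl
  omega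

/-- Otherwise a path through `p` could always be prolonged by another non-leaf, giving paths longer
than the number of vertices. -/
theorem exists_path_isPendant [Finite V] (h : IsCanonical G r u) {p : V} (hup : G.Adj u p)
    (hp1 : deg G p ≠ 1) : ∃ (z : V) (w : G.Walk u z), w.IsPath ∧ w.snd = p ∧ deg G z ≠ 1 ∧
      ¬ w.Nil ∧ IsPendant G z w.penultimate := by
  by_contra hcon
  push Not at hcon
  have key : ∀ n : ℕ, ∃ (z : V) (w : G.Walk u z), w.IsPath ∧ w.snd = p ∧ deg G z ≠ 1 ∧
      w.length = n + 1 := by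
    intro n
    induction n with
    | zero => exact ⟨p, hup.toWalk, by simpa using hup.ne, by simp, hp1, by simp⟩
    | succ n ih =>
      obtain ⟨z, w, hw, hs, hz, hlen⟩ := ih
      have hnil : ¬ w.Nil := by rw [← Walk.length_eq_zero_iff]; omega
      have := hcon z w hw hs hz hnil
      unfold IsPendant at this
      push Not at this
      obtain ⟨x, hzx, hx, hx1⟩ := this
      refine ⟨x, w.concat hzx, hw.concat (fun hmem => hx
        (h.isTree.isAcyclic.eq_penultimate_of_adj_end hw hzx hmem)) hzx, ?_, hx1, by simp [hlen]⟩
      rw [← hs]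
      cases w with
      | nil => simp at hnil
      | cons a b => simp [Walk.concat_cons]
  have := Fintype.ofFinite V
  obtain ⟨z, w, hw, -, -, hlen⟩ := key (Fintype.card V)
  have := hw.length_lt
  omega

/-- The penultimate vertex is a non-leaf and so outranks `u`; alternation compares its branch `z`
with the branch `q` of `u`. -/
theorem lt_of_penultimate_ne (h : IsCanonical G r u) {z q : V} {w : G.Walk u z} (hw : w.IsPath)
    (hnil : ¬ w.Nil) (hc : w.penultimate ≠ u) (huq : G.Adj u q) (hq : q ∉ w.support) :
    r z < r q := by
  have hadj := Walk.adj_penultimate hnil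
  have hc1 : deg G w.penultimate ≠ 1 :=
    deg_ne_one_of_mem_support hw (Walk.getVert_mem_support _ _) hc hadj.ne
  have h2 := hw
  rw [← Walk.concat_dropLast hadj, Walk.concat_isPath_iff] at h2
  refine h.alternating w.penultimate u z q w.dropLast.reverse h2.1.reverse hadj huq
    (by rw [Walk.support_reverse, List.mem_reverse]; exact h2.2) (fun hmem => hq ?_)
    (h.lt_of_ne _ hc1 hc)
  rw [Walk.support_reverse, List.mem_reverse] at hmem
  rw [← Walk.concat_dropLast hadj]
  exact Walk.support_subset_support_concat _ _ hmem

/-- Follow the branch of `p` to a last non-leaf `z`. As `p` is not pendant, `z` does not hang from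
`u`, so `q` outranks `z`; the leaf at `z` then forces `q` to be pendant. -/
theorem isPendant_of_not_isPendant [Finite V] (h : IsCanonical G r u)
    (hcard : deg G u + 2 ≤ {v | deg G v ≠ 1}.ncard) {p q : V} (hup : G.Adj u p)
    (hp : ¬ IsPendant G p u) (huq : G.Adj u q) (hqp : q ≠ p) : IsPendant G q u := by
  have hac := h.isTree.isAcyclic
  obtain ⟨z, w, hw, hs, hz, hnil, hpend⟩ :=
    h.exists_path_isPendant hup (h.deg_ne_one_of_adj hcard hup)
  obtain ⟨y, hzy, hy⟩ := exists_adj_of_two_le_deg (h.two_le_deg z hz) w.penultimate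
  have hq : q ∉ w.support := fun hmem =>
    hqp ((hac.eq_snd_of_adj_start hw huq hmem).trans hs)
  have hc : w.penultimate ≠ u := by
    intro hc
    have huz := Walk.adj_penultimate hnil
    rw [hc] at huz hpend
    have hzp : z = p := (hac.eq_snd_of_adj_start hw huz w.end_mem_support).trans hs
    exact hp (hzp ▸ hpend)
  have hlt := h.lt_of_penultimate_ne hw hnil hc huq hq
  have := h.isPendant_snd (h.deg_ne_one_of_adj hcard huq) hzy (hpend y hzy hy) hlt
    (p := Walk.cons huq.symm w) (hw.cons hq)
  simpa using this

/-- This is what gives the pendant neighbours of `u` the largest degrees. If `z` is not adjacent to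
`u`, alternation at the penultimate vertex decides; if `z = p` outranked `q`, a leaf at `q` would
make `p` pendant. -/
theorem lt_of_isPendant [Finite V] (h : IsCanonical G r u) {p q z : V}
    (hp : ¬ IsPendant G p u) (huq : G.Adj u q) (hqp : q ≠ p) (hq1 : deg G q ≠ 1)
    (hq : IsPendant G q u) (hz : deg G z ≠ 1) (hzu : z ≠ u) (hzp : ¬ G.Adj u z ∨ z = p) :
    r z < r q := by
  have hac := h.isTree.isAcyclic
  have hzq : z ≠ q := by
    rintro rfl
    rcases hzp with hzp | hzp
    · exact hzp huq
    · exact hqp hzp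
  by_contra hlt
  have hlt' : r q < r z := lt_of_le_of_ne (not_lt.1 hlt) fun he => hzq (h.injective he).symm
  obtain ⟨w, hw, -⟩ := h.isTree.existsUnique_path u z
  have hqw : q ∉ w.support := fun hmem =>
    hzq (eq_of_isPendant hq hz hw hmem).symm
  have hnil : ¬ w.Nil := Walk.not_nil_of_ne hzu.symm
  have hadj := Walk.adj_penultimate hnil
  by_cases hc : w.penultimate = u
  · rw [hc] at hadj
    have hzp : z = p := hzp.resolve_left (not_not_intro hadj)
    obtain ⟨y, hqy, hy⟩ := exists_adj_of_two_le_deg (h.two_le_deg q hq1) u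
    have hpend := h.isPendant_snd hz hqy (hq y hqy hy) hlt'
      (p := (Walk.cons huq.symm w).reverse) (hw.cons hqw).reverse
    rw [Walk.snd_reverse, Walk.penultimate_cons_of_not_nil _ _ hnil, hc, hzp] at hpend
    exact hp hpend
  · exact hlt (h.lt_of_penultimate_ne hw hnil hc huq hqw)

/-- If all neighbours of `u` were pendant, every other non-leaf would be a neighbour of `u`,
contradicting the count. -/
theorem exists_adj_not_isPendant [Finite V] (h : IsCanonical G r u)
    (hcard : deg G u + 2 ≤ {v | deg G v ≠ 1}.ncard) : ∃ p, G.Adj u p ∧ ¬ IsPendant G p u := by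
  by_contra hcon
  push Not at hcon
  have hsub : {v | deg G v ≠ 1} \ {u} ⊆ G.neighborSet u := by
    rintro z ⟨hz, hzu⟩
    obtain ⟨w, hw, -⟩ := h.isTree.existsUnique_path u z
    have hadj := Walk.adj_snd (p := w) (Walk.not_nil_of_ne (Ne.symm hzu))
    rw [← eq_of_isPendant (hcon _ hadj) hz hw (Walk.getVert_mem_support _ _)]
    exact hadj
  have h1 := Set.ncard_le_ncard hsub
  have := Set.ncard_sdiff_singleton_add_one (s := {v | deg G v ≠ 1}) (a := u) h.deg_ne_one
  have hd : deg G u = (G.neighborSet u).ncard := rfl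
  omega

end IsCanonical

/-! ### Degree sequences as multisets -/

/-- The multiset `{n}`, or the empty multiset if `n = 1`. -/
def nonleafDegree (n : ℕ) : Multiset ℕ := if n = 1 then 0 else {n}

theorem nonleafDegree_one : nonleafDegree 1 = 0 := rfl

theorem nonleafDegree_of_ne {n : ℕ} (h : n ≠ 1) : nonleafDegree n = {n} := if_neg h

/-- The multiset of the degrees of the non-leaf vertices. -/
noncomputable def degreeMultiset {V : Type} (G : SimpleGraph V) : Multiset ℕ :=
  ∑ᶠ v, nonleafDegree (deg G v)

theorem degreeMultiset_eq_sum {V : Type} [Fintype V] (G : SimpleGraph V) :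
    degreeMultiset G = ∑ v, nonleafDegree (deg G v) := finsum_eq_sum_of_fintype _

open Classical in
theorem degreeMultiset_eq_map {V : Type} [Fintype V] (G : SimpleGraph V) :
    degreeMultiset G = (Finset.univ.filter fun v => deg G v ≠ 1).val.map (deg G) := by
  rw [degreeMultiset_eq_sum, ← Multiset.sum_map_singleton (Multiset.map _ _), Multiset.map_map]
  change _ = ∑ v ∈ Finset.univ.filter (fun v => deg G v ≠ 1), ({deg G v} : Multiset ℕ)
  rw [Finset.sum_filter]
  refine Finset.sum_congr rfl fun v _ => ?_
  by_cases h : deg G v = 1 <;> simp [nonleafDegree, h]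

theorem coe_degreeSequence {V : Type} [Fintype V] (G : SimpleGraph V) :
    (degreeSequence G : Multiset ℕ) = degreeMultiset G := by
  classical
  rw [degreeSequence, Multiset.sort_eq, degreeMultiset_eq_map]
  simp only [degree_eq_deg]

theorem degreeSequence_eq_iff {V : Type} [Fintype V] (G : SimpleGraph V) {D : List ℕ}
    (hD : D.Pairwise (· ≥ ·)) : degreeSequence G = D ↔ degreeMultiset G = D := by
  rw [← coe_degreeSequence, Multiset.coe_eq_coe]
  refine ⟨fun h => h ▸ List.Perm.refl _, fun h => h.eq_of_pairwise' ?_ hD⟩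
  exact Multiset.pairwise_sort _ _

theorem degreeMultiset_congr {V W : Type} {G : SimpleGraph V} {H : SimpleGraph W} (e : V ≃ W)
    (h : ∀ v, deg H (e v) = deg G v) : degreeMultiset G = degreeMultiset H := by
  unfold degreeMultiset
  exact finsum_eq_of_bijective e e.bijective fun v => by rw [h]

theorem mem_degreeMultiset {V : Type} [Finite V] {G : SimpleGraph V} {d : ℕ} :
    d ∈ degreeMultiset G ↔ ∃ v, deg G v ≠ 1 ∧ deg G v = d := by
  have := Fintype.ofFinite V
  classical
  rw [degreeMultiset_eq_map]
  simp

theorem card_degreeMultiset {V : Type} [Finite V] (G : SimpleGraph V) :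
    (degreeMultiset G).card = {v | deg G v ≠ 1}.ncard := by
  have := Fintype.ofFinite V
  classical
  rw [degreeMultiset_eq_map, Multiset.card_map, Finset.card_val, ← Set.ncard_coe_finset]
  simp

/-! ### Isomorphisms -/

theorem deg_iso {V W : Type} {G : SimpleGraph V} {H : SimpleGraph W} (f : G ≃g H) (v : V) :
    deg H (f v) = deg G v := by
  rw [deg, deg, ← Set.ncard_image_of_injective _ f.injective]
  congr 1
  ext w
  constructor
  · intro h
    exact ⟨f.symm w, by simpa using f.symm.map_rel_iff.2 h, by simp⟩
  · rintro ⟨x, hx, rfl⟩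
    exact f.map_rel_iff.2 hx

theorem edgeSum_iso {V W M : Type} [AddCommMonoid M] {G : SimpleGraph V} {H : SimpleGraph W}
    (f : G ≃g H) (φ : Sym2 W → M) : edgeSum H φ = edgeSum G fun e => φ (e.map f) := by
  refine Eq.trans ?_ (edgeSum_map f.toEquiv.toEmbedding G φ)
  congr 1
  ext x y
  rw [map_adj]
  constructor
  · intro h
    exact ⟨f.symm x, f.symm y, f.symm.map_rel_iff.2 h, by simp, by simp⟩
  · rintro ⟨a, b, hab, rfl, rfl⟩
    exact f.map_rel_iff.2 hab

/-! ### Merging a rooted graph into a graph -/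

section Merge

variable (T : FiniteGraph) (v : T.V) (S : RootedGraph)

/-- The inclusion of `T` into the merged graph. -/
def mergeInl : T.V ↪ (merge T v S).V := Function.Embedding.inl

open Classical in
/-- The map from the vertices of `S` to those of the merged graph. -/
noncomputable def mergeMap (w : S.V) : T.V ⊕ {w : S.V // w ≠ S.root} :=
  if h : w = S.root then Sum.inl v else Sum.inr ⟨w, h⟩

theorem mergeMap_injective : Function.Injective (mergeMap T v S) := by
  intro x y h
  unfold mergeMap at h
  split_ifs at h with hx hy hy
  · exact hx.trans hy.symm
  · exact congrArg Subtype.val (Sum.inr_injective h)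

/-- The inclusion of `S` into the merged graph. -/
noncomputable def mergeInr : S.V ↪ (merge T v S).V := ⟨mergeMap T v S, mergeMap_injective T v S⟩

theorem mergeInr_root : mergeInr T v S S.root = mergeInl T v S v :=
  dif_pos (c := S.root = S.root) rfl

theorem mergeInr_of_ne {w : S.V} (h : w ≠ S.root) : mergeInr T v S w = Sum.inr ⟨w, h⟩ :=
  dif_neg (c := w = S.root) h

theorem mergeInr_eq_mergeInl_iff {w : S.V} {t : T.V} :
    mergeInr T v S w = mergeInl T v S t ↔ w = S.root ∧ t = v := by
  by_cases h : w = S.root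
  · subst h
    rw [mergeInr_root, (mergeInl T v S).injective.eq_iff]
    simp [eq_comm]
  · rw [mergeInr_of_ne T v S h]
    exact ⟨fun h' => absurd h' Sum.inr_ne_inl, fun h' => absurd h'.1 h⟩

theorem merge_adj (x y : T.V ⊕ {w : S.V // w ≠ S.root}) :
    (merge T v S).graph.Adj x y ↔ x ≠ y ∧ (MergeRel T v S x y ∨ MergeRel T v S y x) := Iff.rfl

/-- As an edge-disjoint union, the merged graph has additive edge sums, hence additive edge counts,
degrees and weights. -/
theorem merge_graph_eq :
    (merge T v S).graph = T.graph.map (mergeInl T v S) ⊔ S.graph.map (mergeInr T v S) := by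
  ext x y
  rw [sup_adj, map_adj, map_adj]
  refine (merge_adj T v S x y).trans ?_
  constructor
  · rintro ⟨-, h⟩
    rcases x with a | a <;> rcases y with b | b
    · exact Or.inl ⟨a, b, h.elim id fun h => T.graph.adj_symm h, rfl, rfl⟩
    · obtain ⟨rfl, h'⟩ := h.resolve_right id
      exact Or.inr ⟨S.root, b.1, h', mergeInr_root T a S, mergeInr_of_ne T a S b.2⟩
    · obtain ⟨rfl, h'⟩ := h.resolve_left id
      exact Or.inr ⟨a.1, S.root, h'.symm, mergeInr_of_ne T b S a.2, mergeInr_root T b S⟩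
    · exact Or.inr ⟨a.1, b.1, h.elim id fun h => S.graph.adj_symm h, mergeInr_of_ne T v S a.2,
        mergeInr_of_ne T v S b.2⟩
  · rintro (⟨a, b, h, rfl, rfl⟩ | ⟨a, b, h, rfl, rfl⟩)
    · exact ⟨fun he => h.ne ((mergeInl T v S).injective he), Or.inl h⟩
    · refine ⟨fun he => h.ne ((mergeInr T v S).injective he), ?_⟩
      by_cases ha : a = S.root
      · subst ha
        rw [mergeInr_root, mergeInr_of_ne T v S h.ne']
        exact Or.inl ⟨rfl, h⟩
      · rw [mergeInr_of_ne T v S ha]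
        by_cases hb : b = S.root
        · subst hb
          rw [mergeInr_root]
          exact Or.inr ⟨rfl, h.symm⟩
        · rw [mergeInr_of_ne T v S hb]
          exact Or.inl h

theorem merge_disjoint :
    Disjoint (T.graph.map (mergeInl T v S)) (S.graph.map (mergeInr T v S)) := by
  rw [disjoint_left]
  intro x y h1 h2
  rw [map_adj] at h1 h2
  obtain ⟨a, b, -, rfl, rfl⟩ := h1
  obtain ⟨c, d, hcd, hc, hd⟩ := h2
  rw [mergeInr_eq_mergeInl_iff] at hc hd
  exact hcd.ne (hc.1.trans hd.1.symm)

theorem edgeSum_merge {M : Type} [AddCommMonoid M] (φ : Sym2 (merge T v S).V → M) :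
    edgeSum (merge T v S).graph φ = edgeSum T.graph (fun e => φ (e.map (mergeInl T v S))) +
      edgeSum S.graph fun e => φ (e.map (mergeInr T v S)) := by
  rw [merge_graph_eq, edgeSum_sup (merge_disjoint T v S), edgeSum_map, edgeSum_map]

theorem edgeSum_zero {V M : Type} [AddCommMonoid M] (G : SimpleGraph V) :
    (edgeSum G fun _ => (0 : M)) = 0 := by
  simp [edgeSum]

open Classical in
theorem deg_merge_inl (t : T.V) : deg (merge T v S).graph (mergeInl T v S t) =
    deg T.graph t + if t = v then deg S.graph S.root else 0 := by
  rw [deg_eq_edgeSum, edgeSum_merge, deg_eq_edgeSum, deg_eq_edgeSum]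
  congr 1
  · congr 1
    ext e
    simp [Sym2.mem_map, (mergeInl T v S).injective.eq_iff]
  · split_ifs with h
    · subst h
      congr 1
      ext e
      simp [Sym2.mem_map, mergeInr_eq_mergeInl_iff]
    · refine Eq.trans ?_ (edgeSum_zero S.graph)
      congr 1
      ext e
      simp [Sym2.mem_map, mergeInr_eq_mergeInl_iff, h]

theorem deg_merge_inr {w : S.V} (h : w ≠ S.root) :
    deg (merge T v S).graph (mergeInr T v S w) = deg S.graph w := by
  classical
  rw [deg_eq_edgeSum, edgeSum_merge, deg_eq_edgeSum]
  refine (congrArg₂ (· + ·) ?_ ?_).trans (zero_add _)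
  · refine Eq.trans ?_ (edgeSum_zero T.graph)
    congr 1
    ext e
    have : ∀ t, mergeInl T v S t ≠ mergeInr T v S w := fun t ht =>
      h ((mergeInr_eq_mergeInl_iff T v S).1 ht.symm).1
    simp [Sym2.mem_map, this]
  · congr 1
    ext e
    simp [Sym2.mem_map, (mergeInr T v S).injective.eq_iff]

theorem card_merge : Nat.card (merge T v S).V + 1 = Nat.card T.V + Nat.card S.V := by
  classical
  change Nat.card (T.V ⊕ {w : S.V // w ≠ S.root}) + 1 = _
  have := Nat.card_congr (Equiv.optionSubtypeNe S.root)
  rw [Finite.card_option] at this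
  rw [Nat.card_sum, add_assoc, this]

theorem isTree_merge (hT : T.graph.IsTree) (hS : S.graph.IsTree) :
    (merge T v S).graph.IsTree := by
  rw [isTree_iff_connected_and_edgeSum] at hT hS ⊢
  have hreach : ∀ x, (merge T v S).graph.Reachable (mergeInl T v S v) x := by
    have hl : T.graph.map (mergeInl T v S) ≤ (merge T v S).graph := by
      rw [merge_graph_eq]; exact le_sup_left
    have hr : S.graph.map (mergeInr T v S) ≤ (merge T v S).graph := by
      rw [merge_graph_eq]; exact le_sup_right
    rintro (t | w)
    · exact ((hT.1.preconnected v t).map (Embedding.map _ _).toHom).mono hl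
    · have := ((hS.1.preconnected S.root w.1).map (Embedding.map (mergeInr T v S) _).toHom).mono hr
      change (merge T v S).graph.Reachable (mergeInr T v S S.root) (mergeInr T v S w.1) at this
      rwa [mergeInr_root, mergeInr_of_ne T v S w.2] at this
  have hne : Nonempty (merge T v S).V := ⟨mergeInl T v S v⟩
  refine ⟨⟨fun x y => (hreach x).symm.trans (hreach y)⟩, ?_⟩
  have := card_merge T v S
  rw [edgeSum_merge]
  omega

/-- The contribution of the root of `S` stands on the left to avoid multiset subtraction; it is
empty when the root has degree 1. -/
theorem degreeMultiset_merge (hv : deg T.graph v = 1) :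
    degreeMultiset (merge T v S).graph + nonleafDegree (deg S.graph S.root) =
      degreeMultiset T.graph + degreeMultiset S.graph +
        nonleafDegree (1 + deg S.graph S.root) := by
  classical
  have h1 : degreeMultiset (merge T v S).graph =
      ∑ t, nonleafDegree (deg (merge T v S).graph (mergeInl T v S t)) +
        ∑ w : {w : S.V // w ≠ S.root}, nonleafDegree (deg S.graph w.1) := by
    have h2 : ∀ w : {w : S.V // w ≠ S.root}, deg S.graph w.1 =
        deg (merge T v S).graph (Sum.inr w : T.V ⊕ {w : S.V // w ≠ S.root}) := fun w => by
      rw [← deg_merge_inr T v S w.2, mergeInr_of_ne T v S w.2]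
    simp only [h2]
    exact (finsum_eq_sum_of_fintype _).trans (Fintype.sum_sum_type _)
  have h3 : ∑ t, nonleafDegree (deg (merge T v S).graph (mergeInl T v S t)) =
      degreeMultiset T.graph + nonleafDegree (1 + deg S.graph S.root) := by
    rw [degreeMultiset_eq_sum, Fintype.sum_eq_add_sum_subtype_ne _ v,
      Fintype.sum_eq_add_sum_subtype_ne (fun t => nonleafDegree (deg T.graph t)) v,
      deg_merge_inl, if_pos rfl, hv, nonleafDegree_one, zero_add, add_comm]
    congr 1
    refine Finset.sum_congr rfl fun t _ => ?_
    rw [deg_merge_inl, if_neg t.2, add_zero]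
  rw [h1, h3, degreeMultiset_eq_sum S.graph, Fintype.sum_eq_add_sum_subtype_ne _ S.root]
  abel

end Merge

/-! ### The rooted trees of height at most two -/

section RootedSubtree

variable {cs : List ℕ} {l : ℕ}

/-- The graph underlying `rootedSubtree cs l`. -/
abbrev subtreeGraph (cs : List ℕ) (l : ℕ) : SimpleGraph (SubtreeVertex cs l) :=
  fromRel (IsParent cs l)

/-- The parent of a vertex different from the root. -/
def subtreeParent (cs : List ℕ) (l : ℕ) :
    (Fin cs.length ⊕ Fin l) ⊕ (Σ i : Fin cs.length, Fin (cs.get i - 1)) → SubtreeVertex cs l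
  | Sum.inl _ => none
  | Sum.inr p => some (Sum.inl (Sum.inl p.1))

theorem isParent_iff (x y : SubtreeVertex cs l) :
    IsParent cs l x y ↔ ∃ z, y = some z ∧ subtreeParent cs l z = x := by
  rcases x with _ | ((i | j) | ⟨i, p⟩) <;> rcases y with _ | ((i' | j') | ⟨i', p'⟩) <;>
    simp [IsParent, subtreeParent]

theorem subtreeGraph_adj (x y : SubtreeVertex cs l) :
    (subtreeGraph cs l).Adj x y ↔ IsParent cs l x y ∨ IsParent cs l y x := by
  change x ≠ y ∧ _ ↔ _
  refine ⟨fun h => h.2, fun h => ⟨?_, h⟩⟩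
  rintro rfl
  rcases x with _ | ((i | j) | ⟨i, p⟩) <;> simp [IsParent] at h

theorem subtreeParent_edge_injective :
    Function.Injective fun z => s(subtreeParent cs l z, some z) := by
  intro z z' h
  rcases Sym2.eq_iff.1 h with h | h
  · exact Option.some_injective _ h.2
  · exfalso
    rcases z with (i | j) | ⟨i, p⟩ <;> rcases z' with (i' | j') | ⟨i', p'⟩ <;>
      simp [subtreeParent] at h

theorem isTree_subtreeGraph (cs : List ℕ) (l : ℕ) : (subtreeGraph cs l).IsTree := by
  rw [isTree_iff_connected_and_card]
  have hadj : ∀ z, (subtreeGraph cs l).Adj (some z) (subtreeParent cs l z) := fun z =>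
    (subtreeGraph_adj _ _).2 (Or.inr ((isParent_iff _ _).2 ⟨z, rfl, rfl⟩))
  have hroot : ∀ x : SubtreeVertex cs l, (subtreeGraph cs l).Reachable x none := by
    rintro (_ | (i | p))
    · exact Reachable.refl _
    · exact (hadj (Sum.inl i)).reachable
    · exact (hadj (Sum.inr p)).reachable.trans (hadj (Sum.inl (Sum.inl p.1))).reachable
  refine ⟨⟨fun x y => (hroot x).trans (hroot y).symm⟩, ?_⟩
  have hedge : (subtreeGraph cs l).edgeSet =
      Set.range fun z => s(subtreeParent cs l z, some z) := by
    ext e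
    induction e with | _ x y =>
    rw [mem_edgeSet, subtreeGraph_adj, isParent_iff, isParent_iff]
    constructor
    · rintro (⟨z, rfl, rfl⟩ | ⟨z, rfl, rfl⟩)
      · exact ⟨z, rfl⟩
      · exact ⟨z, Sym2.eq_swap⟩
    · rintro ⟨z, hz⟩
      rcases Sym2.eq_iff.1 hz with ⟨rfl, rfl⟩ | ⟨rfl, rfl⟩
      · exact Or.inl ⟨z, rfl, rfl⟩
      · exact Or.inr ⟨z, rfl, rfl⟩
  rw [hedge, Nat.card_range_of_injective subtreeParent_edge_injective]
  exact Finite.card_option.symm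

theorem deg_subtreeGraph_root :
    deg (subtreeGraph cs l) (none : SubtreeVertex cs l) = cs.length + l := by
  have : (subtreeGraph cs l).neighborSet (none : SubtreeVertex cs l) =
      Set.range fun z : Fin cs.length ⊕ Fin l => (some (Sum.inl z) : SubtreeVertex cs l) := by
    ext y
    rw [mem_neighborSet]
    rw [subtreeGraph_adj]
    rcases y with _ | ((i | j) | ⟨i, p⟩) <;> simp [IsParent]
  rw [deg, this, ← Nat.card_coe_set_eq, Nat.card_range_of_injective (fun a b h => by simpa using h)]
  simp

theorem deg_subtreeGraph_child (i : Fin cs.length) :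
    deg (subtreeGraph cs l) (some (Sum.inl (Sum.inl i)) : SubtreeVertex cs l) =
      1 + (cs.get i - 1) := by
  have : (subtreeGraph cs l).neighborSet
      (some (Sum.inl (Sum.inl i)) : SubtreeVertex cs l) =
      Set.range fun z : Option (Fin (cs.get i - 1)) =>
        (z.map fun p => Sum.inr ⟨i, p⟩ : SubtreeVertex cs l) := by
    ext y
    rw [mem_neighborSet]
    rw [subtreeGraph_adj]
    rcases y with _ | ((i' | j) | ⟨i', p⟩)
    · simp only [IsParent, false_or, Set.mem_range, true_iff]
      exact ⟨none, rfl⟩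
    · simp [IsParent]
    · simp [IsParent]
    · simp only [IsParent, or_false, Set.mem_range]
      constructor
      · rintro rfl
        exact ⟨some p, rfl⟩
      · rintro ⟨_ | z, hz⟩
        · simp at hz
        · simp only [Option.map_some, Option.some.injEq, Sum.inr.injEq, Sigma.mk.injEq] at hz
          exact hz.1.symm
  rw [deg, this, ← Nat.card_coe_set_eq, Nat.card_range_of_injective]
  · simp [add_comm]
  · refine Option.map_injective fun p q h => ?_
    simpa using h

theorem deg_subtreeGraph_leaf (j : Fin l) :
    deg (subtreeGraph cs l) (some (Sum.inl (Sum.inr j)) : SubtreeVertex cs l) = 1 := by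
  rw [deg, Set.ncard_eq_one]
  refine ⟨(none : SubtreeVertex cs l), ?_⟩
  ext y
  rw [mem_neighborSet]
  rw [subtreeGraph_adj]
  rcases y with _ | ((i' | j) | ⟨i', p⟩) <;> simp [IsParent]

theorem deg_subtreeGraph_grandchild (z : Σ i : Fin cs.length, Fin (cs.get i - 1)) :
    deg (subtreeGraph cs l) (some (Sum.inr z) : SubtreeVertex cs l) = 1 := by
  rw [deg, Set.ncard_eq_one]
  refine ⟨(some (Sum.inl (Sum.inl z.1)) : SubtreeVertex cs l), ?_⟩
  ext y
  rw [mem_neighborSet]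
  rw [subtreeGraph_adj]
  rcases y with _ | ((i' | j) | ⟨i', p⟩) <;> simp [IsParent, eq_comm]

theorem degreeMultiset_subtreeGraph (hcs : ∀ c ∈ cs, 2 ≤ c) :
    degreeMultiset (subtreeGraph cs l) =
      nonleafDegree (cs.length + l) + (cs : Multiset ℕ) := by
  have h1 : degreeMultiset (subtreeGraph cs l) =
      ∑ x : SubtreeVertex cs l, nonleafDegree (deg (subtreeGraph cs l) x) :=
    degreeMultiset_eq_sum _
  rw [h1, Fintype.sum_option, Fintype.sum_sum_type, Fintype.sum_sum_type]
  have h2 : ∀ i : Fin cs.length, nonleafDegree (deg (subtreeGraph cs l)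
      (some (Sum.inl (Sum.inl i)) : SubtreeVertex cs l)) = {cs.get i} := fun i => by
    have := hcs _ (cs.get_mem i)
    rw [deg_subtreeGraph_child, nonleafDegree_of_ne (by omega)]
    congr 1
    omega
  simp only [h2, deg_subtreeGraph_leaf, deg_subtreeGraph_grandchild, nonleafDegree_one,
    Finset.sum_const_zero, add_zero]
  congr 1
  · exact congrArg nonleafDegree deg_subtreeGraph_root
  · rw [← List.sum_ofFn]
    have : List.ofFn (fun i : Fin cs.length => ({cs.get i} : Multiset ℕ)) =
        cs.map fun c => {c} := by
      conv_rhs => rw [← List.ofFn_get cs, List.map_ofFn]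
      rfl
    rw [this]
    exact Multiset.sum_map_singleton (cs : Multiset ℕ)

/-- The last clause, that the image is attached to the rest only at `u`, allows the subtree to be
cut off; the clauses about `q` and `f` give surjectivity in the base case. -/
theorem exists_subtreeGraph_embedding {V : Type} [Finite V] {G : SimpleGraph V} {u : V}
    (hu : deg G u ≠ 1) (q : Fin cs.length → V) (hq : Function.Injective q)
    (huq : ∀ i, G.Adj u (q i)) (hqdeg : ∀ i, deg G (q i) = cs.get i) (hcs : ∀ c ∈ cs, 2 ≤ c)
    (hpend : ∀ i, IsPendant G (q i) u) (f : Fin l → V) (hf : Function.Injective f)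
    (huf : ∀ k, G.Adj u (f k)) (hfdeg : ∀ k, deg G (f k) = 1) :
    ∃ j : (subtreeGraph cs l) ↪g G, j (none : SubtreeVertex cs l) = u ∧
      (∀ i, q i ∈ Set.range j) ∧ (∀ i y, G.Adj (q i) y → y ∈ Set.range j) ∧
      (∀ k, f k ∈ Set.range j) ∧
      ∀ w, w ≠ (none : SubtreeVertex cs l) → ∀ y, G.Adj (j w) y → y ∈ Set.range j := by
  have hcard : ∀ i, Nat.card {x // G.Adj (q i) x ∧ x ≠ u} = cs.get i - 1 := by
    intro i
    have h1 : (G.neighborSet (q i) \ {u}).ncard = cs.get i - 1 := by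
      rw [Set.ncard_sdiff_singleton_of_mem (show u ∈ G.neighborSet (q i) from (huq i).symm)]
      exact congrArg (· - 1) (hqdeg i)
    exact h1
  have hε : ∀ i, Nonempty (Fin (cs.get i - 1) ≃ {x // G.Adj (q i) x ∧ x ≠ u}) := fun i =>
    ⟨(Finite.equivFinOfCardEq (hcard i)).symm⟩
  let ε : ∀ i, Fin (cs.get i - 1) ≃ {x // G.Adj (q i) x ∧ x ≠ u} := fun i => (hε i).some
  let j : SubtreeVertex cs l → V
    | none => u
    | some (Sum.inl (Sum.inl i)) => q i
    | some (Sum.inl (Sum.inr k)) => f k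
    | some (Sum.inr z) => (ε z.1 z.2).1
  have hq1 : ∀ i, deg G (q i) ≠ 1 := fun i => by
    have := hcs _ (cs.get_mem i)
    rw [hqdeg]; omega
  have hεadj : ∀ z : Σ i : Fin cs.length, Fin (cs.get i - 1), G.Adj (q z.1) (ε z.1 z.2).1 :=
    fun z => (ε z.1 z.2).2.1
  have hε1 : ∀ z : Σ i : Fin cs.length, Fin (cs.get i - 1), deg G (ε z.1 z.2).1 = 1 := fun z =>
    hpend z.1 _ (hεadj z) (ε z.1 z.2).2.2
  have hεu : ∀ (z : Σ i : Fin cs.length, Fin (cs.get i - 1)) (x), G.Adj (ε z.1 z.2).1 x →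
      x = q z.1 := fun z x hx => eq_of_deg_eq_one (hε1 z) hx (hεadj z).symm
  have hfu : ∀ k x, G.Adj (f k) x → x = u := fun k x hx =>
    eq_of_deg_eq_one (hfdeg k) hx (huf k).symm
  have hqu : ∀ i, q i ≠ u := fun i => (huq i).ne'
  have hinj : Function.Injective j := by
    rintro (_ | ((i | k) | z)) (_ | ((i' | k') | z')) h <;> dsimp only [j] at h
    · rfl
    · exact absurd h.symm (hqu i')
    · exact absurd (hfdeg k') (h ▸ hu)
    · exact absurd (hε1 z') (h ▸ hu)
    · exact absurd h (hqu i)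
    · rw [hq h]
    · exact absurd (hfdeg k') (h ▸ hq1 i)
    · exact absurd (hε1 z') (h ▸ hq1 i)
    · exact absurd (hfdeg k) (h ▸ hu)
    · exact absurd (hfdeg k) (h ▸ hq1 i')
    · rw [hf h]
    · have hk := (huf k).symm
      rw [h] at hk
      exact absurd (hεu z' u hk).symm (hqu _)
    · exact absurd (hε1 z) (by rw [h]; exact hu)
    · exact absurd (hε1 z) (h ▸ hq1 i')
    · exact absurd (hεu z u (h ▸ (huf k').symm)).symm (hqu _)
    · obtain ⟨i, p⟩ := z
      obtain ⟨i', p'⟩ := z'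
      have hi : i = i' := hq (hεu ⟨i', p'⟩ (q i) (h ▸ (hεadj ⟨i, p⟩).symm))
      subst hi
      have hp : p = p' := (ε i).injective (Subtype.ext h)
      rw [hp]
  have hpar : ∀ x y, IsParent cs l x y → G.Adj (j x) (j y) := by
    rintro (_ | ((i | k) | z)) (_ | ((i' | k') | z')) h <;>
      simp only [IsParent] at h <;> dsimp only [j]
    · exact huq i'
    · exact huf k'
    · exact h ▸ hεadj z'
  have hadj : ∀ x y, G.Adj (j x) (j y) → IsParent cs l x y ∨ IsParent cs l y x := by
    rintro (_ | ((i | k) | z)) (_ | ((i' | k') | z')) h <;> dsimp only [j] at h <;>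
      simp only [IsParent, or_true, or_false, false_or]
    · exact h.ne rfl
    · exact hqu _ (hεu z' u h.symm).symm
    · exact hq1 _ (hpend i _ h (hqu i'))
    · exact hqu _ (hfu k' _ h.symm)
    · exact (hq (hεu z' _ h.symm)).symm
    · exact hqu _ (hfu k _ h)
    · exact hu (hfu k _ h ▸ hfdeg k')
    · exact hu (hfu k _ h ▸ hε1 z')
    · exact hqu _ (hεu z u h).symm
    · exact (hq (hεu z _ h)).symm
    · exact hu (hfu k' _ h.symm ▸ hε1 z)
    · exact hq1 _ (hεu z _ h ▸ hε1 z')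
  have hqy : ∀ i y, G.Adj (q i) y → y ∈ Set.range j := by
    intro i y hy
    by_cases hyu : y = u
    · exact ⟨none, hyu.symm⟩
    · refine ⟨some (Sum.inr ⟨i, (ε i).symm ⟨y, hy, hyu⟩⟩), ?_⟩
      dsimp only [j]
      rw [Equiv.apply_symm_apply]
  refine ⟨⟨⟨j, hinj⟩, fun {x y} => ⟨fun h => (subtreeGraph_adj x y).2 (hadj x y h), fun h =>
    ((subtreeGraph_adj x y).1 h).elim (hpar x y) fun h => (hpar y x h).symm⟩⟩, rfl,
    fun i => ⟨some (Sum.inl (Sum.inl i)), rfl⟩, hqy,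
    fun k => ⟨some (Sum.inl (Sum.inr k)), rfl⟩, ?_⟩
  rintro (_ | ((i | k) | z)) hw y hy
  · exact absurd rfl hw
  · exact hqy i y hy
  · exact ⟨none, (hfu k y hy).symm⟩
  · exact ⟨some (Sum.inl (Sum.inl z.1)), (hεu z y hy).symm⟩

end RootedSubtree

/-! ### Decomposing a tree as a merged graph -/

/-- The complement of the image of `S`, together with the image of the root, is the remaining piece.
-/
theorem exists_merge_iso {V : Type} [Finite V] {G : SimpleGraph V} (hG : G.IsTree)
    {S : RootedGraph} (j : S.graph ↪g G)
    (hj : ∀ w, w ≠ S.root → ∀ y, G.Adj (j w) y → y ∈ Set.range j) :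
    ∃ (T : FiniteGraph) (v : T.V), T.graph.IsTree ∧
      ∃ Φ : (merge T v S).graph ≃g G, Φ (mergeInl T v S v) = j S.root := by
  classical
  let P : V → Prop := fun x => x ∉ Set.range j ∨ x = j S.root
  let T : FiniteGraph := ⟨{x // P x}, Fintype.ofFinite _, G.comap Subtype.val⟩
  let v : T.V := (⟨j S.root, Or.inr rfl⟩ : {x // P x})
  let f : T.V ⊕ {w : S.V // w ≠ S.root} → V := Sum.elim Subtype.val fun w => j w.1
  have hP : ∀ x, P x → x ∈ Set.range j → x = j S.root := fun x hx hr => hx.resolve_left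
    (not_not_intro hr)
  have hbij : Function.Bijective f := by
    constructor
    · rintro (⟨a, ha⟩ | ⟨a, ha⟩) (⟨b, hb⟩ | ⟨b, hb⟩) h <;> dsimp only [f, Sum.elim] at h
      · subst h; rfl
      · exact absurd (j.injective (hP _ (h ▸ ha) ⟨b, rfl⟩)) hb
      · exact absurd (j.injective (hP _ (h ▸ hb) ⟨a, rfl⟩)) ha
      · have hab : a = b := j.injective h
        subst hab; rfl
    · intro x
      by_cases hx : P x
      · exact ⟨Sum.inl ⟨x, hx⟩, rfl⟩
      · obtain ⟨hr, hne⟩ := not_or.1 hx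
        obtain ⟨w, rfl⟩ := not_not.1 hr
        exact ⟨Sum.inr ⟨w, fun hw => hne (hw ▸ rfl)⟩, rfl⟩
  have hcross : ∀ (a : T.V) (b : {w : S.V // w ≠ S.root}), G.Adj a.1 (j b.1) ↔
      a = v ∧ S.graph.Adj S.root b.1 := by
    intro a b
    constructor
    · intro h
      have ha := hP _ a.2 (hj b.1 b.2 _ h.symm)
      rw [ha, j.map_adj_iff] at h
      exact ⟨Subtype.ext ha, h⟩
    · rintro ⟨rfl, h⟩
      exact j.map_adj_iff.2 h
  have hadj : ∀ x y, G.Adj (f x) (f y) ↔ (merge T v S).graph.Adj x y := by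
    intro x y
    rw [merge_adj]
    have hne : G.Adj (f x) (f y) → x ≠ y := by
      rintro h rfl
      exact h.ne rfl
    rcases x with a | a <;> rcases y with b | b
    · exact ⟨fun h => ⟨hne h, Or.inl h⟩, fun h => h.2.elim id fun h => G.adj_symm h⟩
    · exact ⟨fun h => ⟨hne h, Or.inl ((hcross a b).1 h)⟩,
        fun h => (hcross a b).2 (h.2.resolve_right id)⟩
    · exact ⟨fun h => ⟨hne h, Or.inr ((hcross b a).1 h.symm)⟩,
        fun h => ((hcross b a).2 (h.2.resolve_left id)).symm⟩
    · exact ⟨fun h => ⟨hne h, Or.inl (j.map_adj_iff.1 h)⟩, fun h =>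
        j.map_adj_iff.2 (h.2.elim id fun h => S.graph.adj_symm h)⟩
  refine ⟨T, v, ⟨?_, hG.isAcyclic.comap ⟨Subtype.val, fun h => h⟩ Subtype.val_injective⟩,
    ⟨Equiv.ofBijective f hbij, fun {x y} => hadj x y⟩, rfl⟩
  -- Collapsing the cut branch onto `v` is a retraction sending edges to edges or single vertices,
  -- so it carries walks of `G` to connections in `T`.
  let ρ : V → T.V := fun x => if hx : P x then (⟨x, hx⟩ : {x // P x}) else v
  have hρ : ∀ x y, G.Adj x y → T.graph.Reachable (ρ x) (ρ y) := by
    have hout : ∀ x y, G.Adj x y → ¬ P x → ρ y = v := by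
      intro x y h hx
      by_cases hy : P y
      · obtain ⟨hr, hne⟩ := not_or.1 hx
        obtain ⟨w, rfl⟩ := not_not.1 hr
        have := hP y hy (hj w (fun hw => hne (hw ▸ rfl)) y h)
        exact (dif_pos hy).trans (Subtype.ext this)
      · exact dif_neg hy
    intro x y h
    by_cases hx : P x
    · by_cases hy : P y
      · rw [show ρ x = (⟨x, hx⟩ : {x // P x}) from dif_pos hx,
          show ρ y = (⟨y, hy⟩ : {x // P x}) from dif_pos hy]
        exact Adj.reachable (G := T.graph) h
      · rw [hout y x h.symm hy, show ρ y = v from dif_neg hy]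
    · rw [hout x y h hx, show ρ x = v from dif_neg hx]
  have hne : Nonempty T.V := ⟨v⟩
  refine ⟨fun x y => ?_⟩
  have hwalk : ∀ {a b : V}, G.Walk a b → T.graph.Reachable (ρ a) (ρ b) := by
    intro a b p
    induction p with
    | nil => rfl
    | cons h _ ih => exact (hρ _ _ h).trans ih
  obtain ⟨p⟩ := hG.connected.preconnected x.1 y.1
  have := hwalk p
  rwa [show ρ x.1 = x from dif_pos x.2, show ρ y.1 = y from dif_pos y.2] at this

/-- A rearrangement of the `T`-part that respects the gluing vertex extends by the identity on `S`,
whose contribution is unchanged. -/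
theorem exists_merge_equiv {T T' : FiniteGraph} {v : T.V} {v' : T'.V} (S : RootedGraph)
    (e : T.V ≃ T'.V) (he : e v = v') (hdeg : ∀ t, deg T'.graph (e t) = deg T.graph t)
    (l : (merge T v S).V → ℕ)
    (hl : edgeSum T.graph (weight (l ∘ mergeInl T v S)) ≤
      edgeSum T'.graph (weight ((l ∘ mergeInl T v S) ∘ e.symm))) :
    ∃ c : (merge T v S).V ≃ (merge T' v' S).V,
      (∀ x, deg (merge T' v' S).graph (c x) = deg (merge T v S).graph x) ∧
      edgeSum (merge T v S).graph (weight l) ≤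
        edgeSum (merge T' v' S).graph (weight (l ∘ c.symm)) := by
  classical
  let c : (merge T v S).V ≃ (merge T' v' S).V := Equiv.sumCongr e (Equiv.refl _)
  have hcl : ∀ t, c (mergeInl T v S t) = mergeInl T' v' S (e t) := fun _ => rfl
  have hcr : ∀ w, c (mergeInr T v S w) = mergeInr T' v' S w := by
    intro w
    by_cases hw : w = S.root
    · subst hw
      rw [mergeInr_root, mergeInr_root, hcl, he]
    · rw [mergeInr_of_ne T v S hw, mergeInr_of_ne T' v' S hw]
      rfl
  refine ⟨c, ?_, ?_⟩
  · rintro (t | w)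
    · change deg _ (c (mergeInl T v S t)) = deg _ (mergeInl T v S t)
      rw [hcl, deg_merge_inl, deg_merge_inl, hdeg, ← he]
      simp only [e.injective.eq_iff]
    · rw [← mergeInr_of_ne T v S w.2, hcr, deg_merge_inr _ _ _ w.2, deg_merge_inr _ _ _ w.2]
  · rw [edgeSum_merge, edgeSum_merge]
    simp only [weight_map]
    have h1 : (l ∘ c.symm) ∘ mergeInl T' v' S = (l ∘ mergeInl T v S) ∘ e.symm := by
      ext t
      simp only [Function.comp_apply]
      rw [← c.symm_apply_apply (mergeInl T v S (e.symm t)), hcl, e.apply_symm_apply]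
    have h2 : (l ∘ c.symm) ∘ mergeInr T' v' S = l ∘ mergeInr T v S := by
      ext w
      simp only [Function.comp_apply]
      rw [← c.symm_apply_apply (mergeInr T v S w), hcr]
    change edgeSum T.graph (weight (l ∘ mergeInl T v S)) +
      edgeSum S.graph (weight (l ∘ mergeInr T v S)) ≤
      edgeSum T'.graph (weight ((l ∘ c.symm) ∘ mergeInl T' v' S)) +
      edgeSum S.graph (weight ((l ∘ c.symm) ∘ mergeInr T' v' S))
    rw [h1, h2]
    gcongr

/-! ### Leaves -/

/-- The path from the leaf to the non-leaf `u` passes through `c`; the presence of `u` rules out a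
single edge. -/
theorem deg_ne_one_of_adj_leaf {V : Type} {G : SimpleGraph V} (hG : G.IsTree) {u x c : V}
    (hu : deg G u ≠ 1) (hx : deg G x = 1) (hxc : G.Adj x c) : deg G c ≠ 1 := by
  obtain ⟨p, hp, -⟩ := hG.existsUnique_path x u
  have hne : x ≠ u := fun h => hu (h ▸ hx)
  have hadj := Walk.adj_snd (p := p) (Walk.not_nil_of_ne hne)
  have hc := eq_of_deg_eq_one hx hxc hadj
  by_cases hcu : c = u
  · rwa [hcu]
  · refine deg_ne_one_of_mem_support hp (hc ▸ Walk.getVert_mem_support _ _) hxc.ne' hcu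

theorem exists_deg_eq_one {V : Type} [Finite V] {G : SimpleGraph V} (hG : G.IsTree) {u : V}
    (hu : 2 ≤ deg G u) : ∃ x, deg G x = 1 := by
  classical
  have := Fintype.ofFinite V
  obtain ⟨y, hy, -⟩ := exists_adj_of_two_le_deg hu u
  have : Nontrivial V := ⟨u, y, hy.ne⟩
  obtain ⟨x, hx⟩ := hG.exists_vert_degree_one_of_nontrivial
  exact ⟨x, by rw [← degree_eq_deg, hx]⟩

theorem exists_adj_of_deg_eq_one {V : Type} {G : SimpleGraph V} {x : V} (hx : deg G x = 1) :
    ∃ c, G.Adj x c := by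
  obtain ⟨a, ha⟩ := Set.ncard_eq_one.1 hx
  exact ⟨a, show a ∈ G.neighborSet x from ha ▸ rfl⟩

theorem mem_leaves {V : Type} [Fintype V] {G : SimpleGraph V} {x : V} :
    x ∈ leaves G ↔ deg G x = 1 := by
  classical
  rw [← degree_eq_deg]
  rfl

theorem exists_adj_of_mem_minLeaves {V : Type} [Fintype V] {G : SimpleGraph V} {v : V}
    (hv : v ∈ minLeaves G) : deg G v = 1 ∧ ∃ c, G.Adj v c ∧
      ∀ x y, deg G x = 1 → G.Adj x y → deg G c ≤ deg G y := by
  classical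
  obtain ⟨hv1, c, hvc, hc⟩ := hv
  refine ⟨mem_leaves.1 hv1, c, hvc, fun x y hx hxy => ?_⟩
  rw [← degree_eq_deg, hc, ← degree_eq_deg]
  exact Nat.sInf_le ⟨y, ⟨x, mem_leaves.2 hx, hxy.symm⟩, rfl⟩

theorem minLeaves_nonempty {V : Type} [Fintype V] {G : SimpleGraph V} (hG : G.IsTree) {u : V}
    (hu : 2 ≤ deg G u) : (minLeaves G).Nonempty := by
  classical
  obtain ⟨x, hx⟩ := exists_deg_eq_one hG hu
  obtain ⟨c, hc⟩ := exists_adj_of_deg_eq_one hx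
  have hne : (leafNeighbors G).Nonempty := ⟨c, x, mem_leaves.2 hx, hc.symm⟩
  obtain ⟨c', ⟨v, hv, hcv⟩, hc'⟩ := Nat.sInf_mem (hne.image fun u => G.degree u)
  exact ⟨v, hv, c', hcv.symm, hc'⟩

/-- Only the two pendant edges change, and the swap puts the larger leaf label next to the smaller
neighbour label. -/
theorem edgeSum_le_edgeSum_swap {V : Type} [Finite V] [DecidableEq V] {G : SimpleGraph V}
    {l : V → ℕ} {a b c d : V} (ha : deg G a = 1) (hb : deg G b = 1) (hac : G.Adj a c)
    (hbd : G.Adj b d) (hc : deg G c ≠ 1) (hd : deg G d ≠ 1) (hab : l a ≤ l b) (hcd : l c ≤ l d) :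
    edgeSum G (weight l) ≤ edgeSum G (weight (l ∘ Equiv.swap a b)) := by
  by_cases hne : a = b
  · subst hne
    simp
  have hca : c ≠ a := hac.ne'
  have hdb : d ≠ b := hbd.ne'
  have hcb : c ≠ b := fun h => hc (h ▸ hb)
  have hda : d ≠ a := fun h => hd (h ▸ ha)
  have hpair : s(a, c) ≠ s(b, d) := by simp [hne, hda.symm]
  have hsub : ({s(a, c), s(b, d)} : Set (Sym2 V)) ⊆ G.edgeSet := by
    rintro e (rfl | rfl)
    · exact hac
    · exact hbd
  have hsum : ∀ φ : Sym2 V → ℝ, edgeSum G φ = φ s(a, c) + φ s(b, d) +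
      ∑ᶠ e ∈ G.edgeSet \ {s(a, c), s(b, d)}, φ e := fun φ => by
    rw [edgeSum, ← finsum_mem_pair hpair, finsum_mem_add_sdiff hsub (Set.toFinite _)]
  rw [hsum, hsum]
  have hrest : ∑ᶠ e ∈ G.edgeSet \ {s(a, c), s(b, d)}, weight (l ∘ Equiv.swap a b) e =
      ∑ᶠ e ∈ G.edgeSet \ {s(a, c), s(b, d)}, weight l e := by
    refine finsum_mem_congr rfl fun e he => ?_
    induction e with | _ x y =>
    obtain ⟨hxy, hnot⟩ := he
    rw [mem_edgeSet] at hxy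
    have hfix : ∀ x y, G.Adj x y → s(x, y) ∉ ({s(a, c), s(b, d)} : Set (Sym2 V)) →
        Equiv.swap a b x = x := by
      intro x y hxy hnot
      apply Equiv.swap_apply_of_ne_of_ne
      · rintro rfl
        exact hnot (Or.inl (by rw [eq_of_deg_eq_one ha hxy hac]))
      · rintro rfl
        exact hnot (Or.inr (by rw [eq_of_deg_eq_one hb hxy hbd]; rfl))
    rw [weight_mk, weight_mk, Function.comp_apply, Function.comp_apply, hfix x y hxy hnot,
      hfix y x hxy.symm (by rwa [Sym2.eq_swap (a := y)])]
  rw [hrest]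
  refine add_le_add_left ?_ _
  simp only [weight_mk, Function.comp_apply, Equiv.swap_apply_left, Equiv.swap_apply_right,
    Equiv.swap_apply_of_ne_of_ne hca hcb, Equiv.swap_apply_of_ne_of_ne hda hdb]
  have := sqrt_add_sqrt_le hab hcd
  linarith

/-! ### Lists and enumerations -/

/-- Sorting `A` and `B` separately and concatenating yields a sorted list, which must be `D`. -/
theorem coe_take_drop {D : List ℕ} (hD : D.Pairwise (· ≥ ·)) {A B : Multiset ℕ}
    (hAB : (D : Multiset ℕ) = A + B) (hle : ∀ a ∈ A, ∀ b ∈ B, b ≤ a) :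
    (D.take A.card : Multiset ℕ) = A ∧ (D.drop A.card : Multiset ℕ) = B := by
  have hD' : D = A.sort (· ≥ ·) ++ B.sort (· ≥ ·) := by
    have hperm : D.Perm (A.sort (· ≥ ·) ++ B.sort (· ≥ ·)) := by
      rw [← Multiset.coe_eq_coe, hAB, ← Multiset.coe_add, Multiset.sort_eq, Multiset.sort_eq]
    refine hperm.eq_of_pairwise' hD ?_
    rw [List.pairwise_append]
    refine ⟨Multiset.pairwise_sort _ _, Multiset.pairwise_sort _ _, fun a ha b hb => ?_⟩
    exact hle a (by simpa using ha) b (by simpa using hb)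
  have hlen : (A.sort (· ≥ ·)).length = A.card := Multiset.length_sort _
  constructor
  · rw [hD', List.take_left' hlen, Multiset.sort_eq]
  · rw [hD', List.drop_left' hlen, Multiset.sort_eq]

theorem exists_list_map_eq {α β : Type} (f : α → β) (cs : List β) :
    ∀ s : Multiset α, s.map f = cs → ∃ L : List α, (L : Multiset α) = s ∧ L.map f = cs := by
  classical
  induction cs with
  | nil => exact fun s hs => ⟨[], by simpa [eq_comm] using hs, rfl⟩
  | cons b cs ih =>
    intro s hs
    obtain ⟨a, ha, hab, hs'⟩ := (Multiset.map_eq_cons f s cs b).2 hs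
    obtain ⟨L, hL, hLf⟩ := ih _ hs'
    exact ⟨a :: L, by rw [← Multiset.cons_coe, hL, Multiset.cons_erase ha], by simp [hab, hLf]⟩

theorem exists_enumeration {α : Type} (f : α → ℕ) (cs : List ℕ) (s : Finset α)
    (h : s.val.map f = cs) : ∃ q : Fin cs.length → α, Function.Injective q ∧
      (∀ x, x ∈ s ↔ x ∈ Set.range q) ∧ ∀ i, f (q i) = cs.get i := by
  obtain ⟨L, hL, rfl⟩ := exists_list_map_eq f cs s.val h
  have hnd : L.Nodup := by rw [← Multiset.coe_nodup, hL]; exact s.nodup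
  refine ⟨fun i => L.get (i.cast (L.length_map f)), ?_, fun x => ?_, fun i => by simp⟩
  · exact (List.nodup_iff_injective_get.1 hnd).comp (Fin.cast_injective _)
  · rw [← Finset.mem_val, ← hL, Multiset.mem_coe, List.mem_iff_get]
    constructor
    · rintro ⟨n, rfl⟩
      exact ⟨n.cast (L.length_map f).symm, rfl⟩
    · rintro ⟨i, rfl⟩
      exact ⟨_, rfl⟩

/-! ### Running the algorithms -/

theorem algorithmOne_concat_of_le {D : List ℕ} {d : ℕ} (h : D.length ≤ d) :
    algorithmOne (D ++ [d]) = [rootedSubtree D (d - D.length)] := by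
  rw [algorithmOne]
  have h1 : (D ++ [d]).getLastD 0 = d := by simp
  have h2 : (D ++ [d]).length = D.length + 1 := by simp
  rw [h1, h2, if_pos (by omega), List.dropLast_concat, Nat.add_sub_add_right]

theorem algorithmOne_concat_of_lt {D : List ℕ} {d : ℕ} (h : d < D.length) :
    algorithmOne (D ++ [d]) =
      rootedSubtree (D.take (d - 1)) 0 :: algorithmOne (D.drop (d - 1)) := by
  rw [algorithmOne]
  have h1 : (D ++ [d]).getLastD 0 = d := by simp
  have h2 : (D ++ [d]).length = D.length + 1 := by simp
  rw [h1, h2, if_neg (by omega), List.dropLast_concat, List.take_append_of_le_length (by omega)]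

theorem algorithmOne_ne_nil (D : List ℕ) : algorithmOne D ≠ [] := by
  rw [algorithmOne]
  split_ifs <;> simp

/-- Here `d` is the last entry, so `D.length ≤ d` is the base condition `d_m ≥ m - 1`. Otherwise the
remaining list is nonempty and shorter. -/
theorem algorithmOne_induction {P : List ℕ → Prop}
    (star : ∀ D d, (D ++ [d]).Pairwise (· ≥ ·) → (∀ c ∈ D ++ [d], 2 ≤ c) → D.length ≤ d →
      P (D ++ [d]))
    (step : ∀ D d, (D ++ [d]).Pairwise (· ≥ ·) → (∀ c ∈ D ++ [d], 2 ≤ c) → d < D.length →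
      P (D.drop (d - 1)) → P (D ++ [d])) :
    ∀ D : List ℕ, D ≠ [] → D.Pairwise (· ≥ ·) → (∀ c ∈ D, 2 ≤ c) → P D := by
  intro D
  induction hn : D.length using Nat.strong_induction_on generalizing D with
  | _ n ih =>
    intro hne hsort h2
    obtain ⟨E, d, rfl⟩ : ∃ E d, D = E ++ [d] :=
      ⟨D.dropLast, D.getLast hne, (List.dropLast_append_getLast hne).symm⟩
    rcases Nat.lt_or_ge d E.length with h | h
    · have hd := h2 d (by simp)
      refine step E d hsort h2 h (ih _ ?_ _ rfl ?_ ?_ ?_)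
      · rw [← hn, List.length_drop, List.length_append, List.length_singleton]
        omega
      · rw [ne_eq, List.drop_eq_nil_iff]
        omega
      · exact ((List.pairwise_append.1 hsort).1).sublist (List.drop_sublist _ _)
      · exact fun c hc => h2 c (List.mem_append_left _ (List.mem_of_mem_drop hc))
    · exact star E d hsort h2 h

theorem AlgorithmTwo.eq_of_singleton {S : RootedGraph} {T : FiniteGraph}
    (h : AlgorithmTwo [S] T) : T = S.toFiniteGraph := by
  cases h with
  | start => rfl
  | step _ _ T v h _ => cases h

theorem AlgorithmTwo.exists_of_cons {S : RootedGraph} {Ss : List RootedGraph} {T : FiniteGraph}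
    (h : AlgorithmTwo (S :: Ss) T) (hne : Ss ≠ []) :
    ∃ (T' : FiniteGraph) (v : T'.V), AlgorithmTwo Ss T' ∧ v ∈ minLeaves T'.graph ∧
      T = merge T' v S := by
  cases h with
  | start => exact absurd rfl hne
  | step _ _ T v h hv => exact ⟨T, v, h, hv, rfl⟩

theorem algorithmTwo_isTree_degreeMultiset : ∀ D : List ℕ, D ≠ [] → D.Pairwise (· ≥ ·) →
    (∀ c ∈ D, 2 ≤ c) → ∀ T, AlgorithmTwo (algorithmOne D) T →
      T.graph.IsTree ∧ degreeMultiset T.graph = D := by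
  refine algorithmOne_induction (fun D d hsort h2 hle T hT => ?_)
    (fun D d hsort h2 hlt ih T hT => ?_)
  · rw [algorithmOne_concat_of_le hle] at hT
    rw [hT.eq_of_singleton]
    refine ⟨isTree_subtreeGraph _ _, ?_⟩
    refine (degreeMultiset_subtreeGraph fun c hc => h2 c (List.mem_append_left _ hc)).trans ?_
    have hd := h2 d (by simp)
    rw [Nat.add_sub_cancel' hle, nonleafDegree_of_ne (by omega), ← Multiset.coe_add, add_comm]
    rfl
  · rw [algorithmOne_concat_of_lt hlt] at hT
    obtain ⟨T', v, hT', hv, rfl⟩ := hT.exists_of_cons (algorithmOne_ne_nil _)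
    obtain ⟨htree, hmult⟩ := ih T' hT'
    refine ⟨isTree_merge _ _ _ htree (isTree_subtreeGraph _ _), ?_⟩
    have hd := h2 d (by simp)
    have hlen : (D.take (d - 1)).length = d - 1 := by rw [List.length_take]; omega
    have hroot : deg (rootedSubtree (D.take (d - 1)) 0).graph
        (rootedSubtree (D.take (d - 1)) 0).root = d - 1 :=
      deg_subtreeGraph_root.trans (by rw [hlen, add_zero])
    have hS : degreeMultiset (rootedSubtree (D.take (d - 1)) 0).graph =
        nonleafDegree (d - 1) + (D.take (d - 1) : Multiset ℕ) :=
      (degreeMultiset_subtreeGraph fun c hc =>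
        h2 c (List.mem_append_left _ (List.mem_of_mem_take hc))).trans (by rw [hlen, add_zero])
    have h := degreeMultiset_merge T' v (rootedSubtree (D.take (d - 1)) 0)
      (exists_adj_of_mem_minLeaves hv).1
    -- The glued vertex has one old edge and `d - 1` new ones, which restores the entry `d`.
    rw [hroot, hS, hmult, show 1 + (d - 1) = d by omega, nonleafDegree_of_ne (n := d) (by omega)]
      at h
    have hD : (D : Multiset ℕ) = (D.take (d - 1) : Multiset ℕ) + (D.drop (d - 1) : Multiset ℕ) := by
      rw [Multiset.coe_add, List.take_append_drop]
    rw [← Multiset.coe_add, hD, ← add_left_inj (nonleafDegree (d - 1)), h]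
    change _ = _ + {d} + _
    abel

theorem exists_two_le_deg_of_degreeMultiset {V : Type} [Finite V] {G : SimpleGraph V} {D : List ℕ}
    (hne : D ≠ []) (h2 : ∀ c ∈ D, 2 ≤ c) (hG : degreeMultiset G = D) : ∃ u, 2 ≤ deg G u := by
  obtain ⟨c, hc⟩ := List.exists_mem_of_ne_nil D hne
  obtain ⟨u, -, hu⟩ := mem_degreeMultiset.1 (show c ∈ degreeMultiset G by rw [hG]; exact hc)
  exact ⟨u, hu ▸ h2 c hc⟩

theorem exists_algorithmTwo : ∀ D : List ℕ, D ≠ [] → D.Pairwise (· ≥ ·) →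
    (∀ c ∈ D, 2 ≤ c) → ∃ T, AlgorithmTwo (algorithmOne D) T := by
  refine algorithmOne_induction (fun D d hsort h2 hle => ?_) (fun D d hsort h2 hlt ih => ?_)
  · rw [algorithmOne_concat_of_le hle]
    exact ⟨_, AlgorithmTwo.start _⟩
  · rw [algorithmOne_concat_of_lt hlt]
    obtain ⟨T, hT⟩ := ih
    have hne : D.drop (d - 1) ≠ [] := by rw [ne_eq, List.drop_eq_nil_iff]; omega
    have h2' : ∀ c ∈ D.drop (d - 1), 2 ≤ c := fun c hc =>
      h2 c (List.mem_append_left _ (List.mem_of_mem_drop hc))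
    obtain ⟨htree, hmult⟩ := algorithmTwo_isTree_degreeMultiset _ hne
      ((List.pairwise_append.1 hsort).1.sublist (List.drop_sublist _ _)) h2' T hT
    obtain ⟨u, hu⟩ := exists_two_le_deg_of_degreeMultiset hne h2' hmult
    obtain ⟨v, hv⟩ := minLeaves_nonempty htree hu
    exact ⟨_, AlgorithmTwo.step _ _ T v hT hv⟩

/-! ### Optimality -/

/-- A labelling that agrees with the degree on the non-leaf vertices and does not exceed any
entry of `D` on the leaves. -/
structure IsLabelling {V : Type} (G : SimpleGraph V) (D : List ℕ) (l : V → ℕ) : Prop where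
  eq_deg : ∀ v, deg G v ≠ 1 → l v = deg G v
  le : ∀ v, deg G v = 1 → ∀ c ∈ D, l v ≤ c

theorem exists_isCanonical {V : Type} [Finite V] {G : SimpleGraph V} (hG : G.IsTree) {D : List ℕ}
    {d : ℕ} (hsort : (D ++ [d]).Pairwise (· ≥ ·)) (h2 : ∀ c ∈ D ++ [d], 2 ≤ c)
    (hmult : degreeMultiset G = (D ++ [d] : List ℕ)) {l : V → ℕ}
    (hl : IsLabelling G (D ++ [d]) l) :
    ∃ (H : SimpleGraph V) (r : V → ℕ) (u : V), IsCanonical H r u ∧ (∀ v, deg H v = deg G v) ∧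
      edgeSum G (weight l) ≤ edgeSum H (weight l) ∧ deg H u = d ∧
      ∀ x y, deg H x ≠ 1 → deg H y ≠ 1 → r x < r y → deg H x ≤ deg H y := by
  classical
  have hmem : ∀ v, deg G v ≠ 1 → deg G v ∈ D ++ [d] := fun v hv => by
    have : deg G v ∈ degreeMultiset G := mem_degreeMultiset.2 ⟨v, hv, rfl⟩
    rwa [hmult] at this
  have hge : ∀ v, deg G v ≠ 1 → d ≤ deg G v := fun v hv => by
    rcases List.mem_append.1 (hmem v hv) with h | h
    · exact (List.pairwise_append.1 hsort).2.2 _ h d (by simp)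
    · exact (List.mem_singleton.1 h).ge
  -- A leaf label may equal `d`; adding 1 at non-leaves ranks every leaf strictly below them, and
  -- the ranking still respects the labels.
  let κ : V → ℕ := fun v => if deg G v = 1 then l v else l v + 1
  have hκ1 : ∀ v, deg G v = 1 → κ v = l v ∧ l v ≤ d := fun v hv =>
    ⟨if_pos hv, hl.le v hv d (by simp)⟩
  have hκ2 : ∀ v, deg G v ≠ 1 → κ v = deg G v + 1 ∧ l v = deg G v := fun v hv =>
    ⟨(if_neg hv).trans (by rw [hl.eq_deg v hv]), hl.eq_deg v hv⟩
  obtain ⟨r, hr, hκr⟩ := exists_injective_rank κ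
  have hrκ : ∀ x y, r x < r y → κ x ≤ κ y := fun x y h =>
    not_lt.1 fun h' => lt_asymm h (hκr y x h')
  have hlr : ∀ x y, r x < r y → l x ≤ l y := by
    intro x y h
    have := hrκ x y h
    by_cases hx : deg G x = 1 <;> by_cases hy : deg G y = 1
    · have := hκ1 x hx; have := hκ1 y hy; omega
    · have := hκ1 x hx; have := hκ2 y hy; have := hge y hy; omega
    · have := hκ2 x hx; have := hκ1 y hy; omega
    · have := hκ2 x hx; have := hκ2 y hy; omega
  obtain ⟨H, hH, hdeg, hsum, halt⟩ := exists_isAlternating hG l r hr hlr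
  obtain ⟨w, hw1, hwd⟩ := mem_degreeMultiset.1
    (show d ∈ degreeMultiset G by rw [hmult]; simp)
  obtain ⟨u, hu1, hu⟩ := Set.exists_min_image {v | deg G v ≠ 1} r (Set.toFinite _) ⟨w, hw1⟩
  have hlt : ∀ z, deg G z ≠ 1 → z ≠ u → r u < r z := fun z hz hzu =>
    lt_of_le_of_ne (hu z hz) fun h => hzu (hr h).symm
  have hmono : ∀ x y, deg G x ≠ 1 → deg G y ≠ 1 → r x < r y → deg G x ≤ deg G y := by
    intro x y hx hy h
    have := hrκ x y h
    have := hκ2 x hx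
    have := hκ2 y hy
    omega
  refine ⟨H, r, u, ⟨hH, halt, hr, ?_, ?_, ?_, ?_⟩, hdeg, hsum, ?_, ?_⟩
  · intro v hv
    rw [hdeg] at hv ⊢
    exact h2 _ (hmem v hv)
  · intro x y hx hy
    rw [hdeg] at hx hy
    apply hκr
    have := hκ1 x hx
    have := hκ2 y hy
    have := hge y hy
    omega
  · rw [hdeg]; exact hu1
  · intro z hz
    rw [hdeg] at hz
    exact hlt z hz
  · rw [hdeg]
    refine le_antisymm ?_ (hge u hu1)
    by_cases hwu : w = u
    · rw [← hwu, hwd]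
    · exact (hmono u w hu1 hw1 (hlt w hw1 hwu)).trans_eq hwd
  · intro x y hx hy
    rw [hdeg, hdeg] at *
    exact hmono x y hx hy

/-- Every labelled tree with degree sequence `D` can be rearranged into `T` without decreasing its
weight. -/
def Dominates (D : List ℕ) (T : FiniteGraph) : Prop :=
  ∀ (V : Type) [Finite V] (G : SimpleGraph V), G.IsTree → degreeMultiset G = D →
    ∀ l, IsLabelling G D l → ∃ e : V ≃ T.V, (∀ v, deg T.graph (e v) = deg G v) ∧
      edgeSum G (weight l) ≤ edgeSum T.graph (weight (l ∘ e.symm))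

open Classical in
theorem erase_val_map_deg {V : Type} [Fintype V] {G : SimpleGraph V} {D : List ℕ} {d : ℕ} {u : V}
    (hmult : degreeMultiset G = (D ++ [d] : List ℕ)) (hu : deg G u ≠ 1) (hud : deg G u = d) :
    ((Finset.univ.filter fun v => deg G v ≠ 1).erase u).val.map (deg G) = D := by
  rw [degreeMultiset_eq_map] at hmult
  have hmem : u ∈ Finset.univ.filter fun v => deg G v ≠ 1 := by simpa using hu
  rw [← Finset.insert_erase hmem, Finset.insert_val_of_notMem (Finset.notMem_erase _ _),
    Multiset.map_cons, hud, ← Multiset.coe_add, add_comm] at hmult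
  exact (Multiset.cons_inj_right d).1 hmult

/-- After rearrangement every non-leaf is `u` or a pendant neighbour of it, so the embedded subtree
is the whole tree. -/
theorem dominates_rootedSubtree {D : List ℕ} {d : ℕ} (hsort : (D ++ [d]).Pairwise (· ≥ ·))
    (h2 : ∀ c ∈ D ++ [d], 2 ≤ c) (hle : D.length ≤ d) :
    Dominates (D ++ [d]) (rootedSubtree D (d - D.length)).toFiniteGraph := by
  classical
  intro V _ G hG hmult l hl
  have := Fintype.ofFinite V
  obtain ⟨H, r, u, hH, hdeg, hsum, hud, -⟩ := exists_isCanonical hG hsort h2 hmult hl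
  have hmultH : degreeMultiset H = (D ++ [d] : List ℕ) := by
    rw [← hmult]
    exact (degreeMultiset_congr (Equiv.refl V) hdeg).symm
  have hcard := card_degreeMultiset H
  rw [hmultH, Multiset.coe_card, List.length_append, List.length_singleton] at hcard
  have hadj : ∀ z, deg H z ≠ 1 → z ≠ u → H.Adj u z := fun z hz hzu =>
    hH.adj_of_card_le (by omega) hz hzu
  obtain ⟨q, hq, hqmem, hqdeg⟩ := exists_enumeration (deg H) D _
    (erase_val_map_deg hmultH hH.deg_ne_one hud)
  have hqi : ∀ i, deg H (q i) ≠ 1 ∧ q i ≠ u := fun i => by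
    have := (hqmem (q i)).2 ⟨i, rfl⟩
    rw [Finset.mem_erase, Finset.mem_filter] at this
    exact ⟨this.2.2, this.1⟩
  have hleaf : Nat.card {x // H.Adj u x ∧ deg H x = 1} = d - D.length := by
    have h1 : H.neighborSet u \ ({v | deg H v ≠ 1} \ {u}) = {x | H.Adj u x ∧ deg H x = 1} := by
      ext x
      simp only [Set.mem_sdiff, mem_neighborSet, Set.mem_ofPred_eq, Set.mem_singleton_iff]
      constructor
      · rintro ⟨h, hx⟩
        exact ⟨h, by_contra fun hx1 => hx ⟨hx1, h.ne'⟩⟩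
      · rintro ⟨h, hx⟩
        exact ⟨h, fun h' => h'.1 hx⟩
    have h3 := Set.ncard_sdiff (s := {v | deg H v ≠ 1} \ {u}) (t := H.neighborSet u)
      fun z hz => hadj z hz.1 hz.2
    have h4 := Set.ncard_sdiff_singleton_add_one (s := {v | deg H v ≠ 1}) (a := u) hH.deg_ne_one
    have h5 : (H.neighborSet u).ncard = d := hud
    rw [h1] at h3
    change {x | H.Adj u x ∧ deg H x = 1}.ncard = _
    omega
  let f := (Finite.equivFinOfCardEq hleaf).symm
  obtain ⟨j, hju, hjq, hjqy, hjf, -⟩ := exists_subtreeGraph_embedding (G := H) (u := u)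
    hH.deg_ne_one q hq (fun i => hadj _ (hqi i).1 (hqi i).2) hqdeg
    (fun c hc => h2 c (List.mem_append_left _ hc))
    (fun i => hH.isPendant_of_forall_adj hadj (hqi i).1 (hqi i).2)
    (fun k => (f k).1) (Subtype.val_injective.comp f.injective) (fun k => (f k).2.1)
    (fun k => (f k).2.2)
  have hint : ∀ x, deg H x ≠ 1 → x = u ∨ ∃ i, q i = x := by
    intro x hx
    by_cases hxu : x = u
    · exact Or.inl hxu
    · exact Or.inr ((hqmem x).1 (by simp [hxu, hx]))
  have hsurj : Function.Surjective j := by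
    intro x
    by_cases hx : deg H x = 1
    · obtain ⟨c, hc⟩ := exists_adj_of_deg_eq_one hx
      have hc1 := deg_ne_one_of_adj_leaf hH.isTree hH.deg_ne_one hx hc
      rcases hint c hc1 with rfl | ⟨i, rfl⟩
      · have := hjf (f.symm ⟨x, hc.symm, hx⟩)
        rwa [f.apply_symm_apply] at this
      · exact hjqy i x hc.symm
    · rcases hint x hx with rfl | ⟨i, rfl⟩
      · exact ⟨_, hju⟩
      · exact hjq i
  let Φ : subtreeGraph D (d - D.length) ≃g H := RelIso.ofSurjective j hsurj
  refine ⟨Φ.symm.toEquiv, fun v => ?_, ?_⟩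
  · rw [← hdeg]
    exact deg_iso Φ.symm v
  · refine hsum.trans (le_of_eq ?_)
    rw [edgeSum_iso Φ]
    simp only [weight_map]
    rfl

theorem dominates_merge {D : List ℕ} {d : ℕ} (hsort : (D ++ [d]).Pairwise (· ≥ ·))
    (h2 : ∀ c ∈ D ++ [d], 2 ≤ c) (hlt : d < D.length) {T : FiniteGraph} (hT : T.graph.IsTree)
    (hmultT : degreeMultiset T.graph = D.drop (d - 1)) {v : T.V} (hv : v ∈ minLeaves T.graph)
    (ih : Dominates (D.drop (d - 1)) T) :
    Dominates (D ++ [d]) (merge T v (rootedSubtree (D.take (d - 1)) 0)) := by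
  classical
  intro V _ G hG hmult l hl
  have := Fintype.ofFinite V
  obtain ⟨H, r, u, hH, hdeg, hsum, hud, hmono⟩ := exists_isCanonical hG hsort h2 hmult hl
  have hmultH : degreeMultiset H = (D ++ [d] : List ℕ) := by
    rw [← hmult]
    exact (degreeMultiset_congr (Equiv.refl V) hdeg).symm
  have hd2 : 2 ≤ d := h2 d (by simp)
  have hcard := card_degreeMultiset H
  rw [hmultH, Multiset.coe_card, List.length_append, List.length_singleton] at hcard
  have hcard' : deg H u + 2 ≤ {v | deg H v ≠ 1}.ncard := by omega
  obtain ⟨p, hup, hp⟩ := hH.exists_adj_not_isPendant hcard'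
  have hD := erase_val_map_deg hmultH hH.deg_ne_one hud
  set I := (Finset.univ.filter fun v => deg H v ≠ 1).erase u with hI
  have hmemI : ∀ x, x ∈ I ↔ deg H x ≠ 1 ∧ x ≠ u := fun x => by
    rw [hI, Finset.mem_erase, Finset.mem_filter]
    simp only [Finset.mem_univ, true_and, and_comm]
  let C := I.filter fun x => H.Adj u x ∧ x ≠ p
  have hC : ∀ x, x ∈ C ↔ H.Adj u x ∧ x ≠ p := fun x => by
    rw [Finset.mem_filter, hmemI]
    exact ⟨fun h => h.2, fun h => ⟨⟨hH.deg_ne_one_of_adj hcard' h.1, h.1.ne'⟩, h⟩⟩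
  have hCcard : C.card = d - 1 := by
    have h1 : (C : Set V) = H.neighborSet u \ {p} := by
      ext x
      exact hC x
    have h3 : (H.neighborSet u).ncard = d := hud
    rw [← Set.ncard_coe_finset, h1,
      Set.ncard_sdiff_singleton_of_mem (show p ∈ H.neighborSet u from hup), h3]
  have hpend : ∀ x ∈ C, IsPendant H x u := fun x hx =>
    hH.isPendant_of_not_isPendant hcard' hup hp ((hC x).1 hx).1 ((hC x).1 hx).2
  have hCI : ∀ x ∈ C, deg H x ≠ 1 := fun x hx => ((hmemI x).1 (Finset.mem_filter.1 hx).1).1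
  -- The degrees other than that of `u` split into those of the pendant neighbours and the rest; the
  -- former dominate, so they are the first `d - 1` entries.
  have hsplit : (D : Multiset ℕ) = C.val.map (deg H) + (I \ C).val.map (deg H) := by
    rw [← Multiset.map_add, ← hD, ← Finset.disjUnion_val (h := Finset.disjoint_sdiff),
      Finset.disjUnion_eq_union, Finset.union_sdiff_of_subset (Finset.filter_subset _ _)]
  have htake := (coe_take_drop (List.pairwise_append.1 hsort).1 hsplit (by
    intro a ha b hb
    obtain ⟨x, hx, rfl⟩ := Multiset.mem_map.1 ha
    obtain ⟨y, hy, rfl⟩ := Multiset.mem_map.1 hb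
    obtain ⟨hyI, hyC⟩ := Finset.mem_sdiff.1 hy
    have hy' := (hmemI y).1 hyI
    refine hmono y x hy'.1 (hCI x hx) (hH.lt_of_isPendant hp ((hC x).1 hx).1 ((hC x).1 hx).2
      (hCI x hx) (hpend x hx) hy'.1 hy'.2 ?_)
    by_contra hcon
    push Not at hcon
    exact hyC ((hC y).2 hcon))).1
  rw [Multiset.card_map, Finset.card_val, hCcard] at htake
  set cs := D.take (d - 1) with hcs
  have hlen : cs.length = d - 1 := by rw [hcs, List.length_take]; omega
  have hcs2 : ∀ c ∈ cs, 2 ≤ c := fun c hc =>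
    h2 c (List.mem_append_left _ (List.mem_of_mem_take hc))
  obtain ⟨q, hq, hqmem, hqdeg⟩ := exists_enumeration (deg H) cs C htake.symm
  have hqC : ∀ i, q i ∈ C := fun i => (hqmem _).2 ⟨i, rfl⟩
  obtain ⟨j, hju, -, -, -, hjclosed⟩ := exists_subtreeGraph_embedding (G := H) (u := u) (l := 0)
    hH.deg_ne_one q hq (fun i => ((hC _).1 (hqC i)).1) hqdeg hcs2 (fun i => hpend _ (hqC i))
    Fin.elim0 (fun k => k.elim0) (fun k => k.elim0) (fun k => k.elim0)
  obtain ⟨T₀, v₀, hT₀, Φ, hΦ⟩ :=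
    exists_merge_iso (S := rootedSubtree cs 0) hH.isTree j hjclosed
  have hroot : deg (rootedSubtree cs 0).graph (rootedSubtree cs 0).root = d - 1 :=
    deg_subtreeGraph_root.trans (by rw [hlen, add_zero])
  have hdegΦ : ∀ t, deg H (Φ (mergeInl T₀ v₀ (rootedSubtree cs 0) t)) =
      deg T₀.graph t + if t = v₀ then d - 1 else 0 := fun t => by
    rw [deg_iso, deg_merge_inl, hroot]
  have hΦu : Φ (mergeInl T₀ v₀ (rootedSubtree cs 0) v₀) = u := hΦ.trans hju
  have hv₀ : deg T₀.graph v₀ = 1 := by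
    have := hdegΦ v₀
    rw [hΦu, if_pos rfl, hud] at this
    omega
  have hmult₀ : degreeMultiset T₀.graph = D.drop (d - 1) := by
    have h := degreeMultiset_merge T₀ v₀ (rootedSubtree cs 0) hv₀
    have hS : degreeMultiset (rootedSubtree cs 0).graph =
        nonleafDegree (d - 1) + (cs : Multiset ℕ) :=
      (degreeMultiset_subtreeGraph hcs2).trans (by rw [hlen, add_zero])
    have hD' : (D : Multiset ℕ) = (cs : Multiset ℕ) + (D.drop (d - 1) : Multiset ℕ) := by
      rw [Multiset.coe_add, List.take_append_drop]
    rw [hroot, hS, degreeMultiset_congr Φ.toEquiv (deg_iso Φ), hmultH,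
      show 1 + (d - 1) = d by omega, nonleafDegree_of_ne (n := d) (by omega),
      ← Multiset.coe_add, hD'] at h
    change _ + {d} + _ = _ at h
    -- The same three summands are added to both sides, turning the merge formula into an equation
    -- for the degrees of `T₀` alone.
    rw [← add_left_inj (nonleafDegree (d - 1) + (cs : Multiset ℕ) + {d}),
      ← add_assoc (degreeMultiset _), ← h]
    abel
  let l₀ : T₀.V → ℕ := (l ∘ Φ) ∘ mergeInl T₀ v₀ (rootedSubtree cs 0)
  have hdegne : ∀ t, t ≠ v₀ →
      deg G (Φ (mergeInl T₀ v₀ (rootedSubtree cs 0) t)) = deg T₀.graph t := fun t ht => by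
    rw [← hdeg, hdegΦ, if_neg ht, add_zero]
  -- The cut vertex, now a leaf, keeps its old degree as its label; this is admissible because `d`
  -- is the smallest entry.
  have hl₀v : l₀ v₀ = d := by
    change l (Φ (mergeInl T₀ v₀ (rootedSubtree cs 0) v₀)) = d
    rw [hΦu, hl.eq_deg u (by rw [← hdeg]; exact hH.deg_ne_one), ← hdeg, hud]
  have hl₀ : IsLabelling T₀.graph (D.drop (d - 1)) l₀ := by
    constructor
    · intro t ht
      have htv : t ≠ v₀ := by rintro rfl; exact ht hv₀
      rw [← hdegne t htv] at ht ⊢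
      exact hl.eq_deg _ ht
    · intro t ht c hc
      by_cases htv : t = v₀
      · rw [htv, hl₀v]
        exact (List.pairwise_append.1 hsort).2.2 c (List.mem_of_mem_drop hc) d (by simp)
      · rw [← hdegne t htv] at ht
        exact hl.le _ ht c (List.mem_append_left _ (List.mem_of_mem_drop hc))
  obtain ⟨e, he, hle⟩ := ih T₀.V T₀.graph hT₀ hmult₀ l₀ hl₀
  obtain ⟨hv1, c, hvc, hmin⟩ := exists_adj_of_mem_minLeaves hv
  have hw1 : deg T.graph (e v₀) = 1 := (he v₀).trans hv₀
  obtain ⟨c', hc'⟩ := exists_adj_of_deg_eq_one hw1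
  obtain ⟨w, hw⟩ := exists_two_le_deg_of_degreeMultiset (D := D.drop (d - 1))
    (by rw [ne_eq, List.drop_eq_nil_iff]; omega)
    (fun c hc => h2 c (List.mem_append_left _ (List.mem_of_mem_drop hc))) hmultT
  have hwne : deg T.graph w ≠ 1 := by omega
  have hc1 := deg_ne_one_of_adj_leaf hT hwne hv1 hvc
  have hc1' := deg_ne_one_of_adj_leaf hT hwne hw1 hc'
  have hlab : ∀ t, deg T.graph t ≠ 1 → (l₀ ∘ e.symm) t = deg T.graph t := by
    intro t ht
    have hdt : deg T.graph t = deg T₀.graph (e.symm t) := by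
      rw [← he, e.apply_symm_apply]
    rw [hdt] at ht ⊢
    exact hl₀.eq_deg _ ht
  -- The label at `e v₀` is `d`, an upper bound for all leaf labels, and the neighbour of `v` has
  -- the least degree among neighbours of leaves.
  have hswap := edgeSum_le_edgeSum_swap (l := l₀ ∘ e.symm) hv1 hw1 hvc hc' hc1 hc1' (by
      simp only [Function.comp_apply, Equiv.symm_apply_apply, hl₀v]
      have hdv : deg T₀.graph (e.symm v) = 1 := by rw [← he, e.apply_symm_apply, hv1]
      by_cases hev : e.symm v = v₀
      · rw [hev, hl₀v]
      · rw [← hdegne _ hev] at hdv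
        exact hl.le _ hdv d (by simp))
    (by rw [hlab c hc1, hlab c' hc1']; exact hmin _ _ hw1 hc')
  let e' : T₀.V ≃ T.V := e.trans (Equiv.swap v (e v₀))
  have he'v : e' v₀ = v := Equiv.swap_apply_right _ _
  have he'deg : ∀ t, deg T.graph (e' t) = deg T₀.graph t := by
    intro t
    rw [← he]
    change deg T.graph (Equiv.swap v (e v₀) (e t)) = _
    rw [Equiv.swap_apply_def]
    split_ifs with h1 h3
    · rw [h1, hv1, hw1]
    · rw [h3, hv1, hw1]
    · rfl
  obtain ⟨k, hk, hksum⟩ := exists_merge_equiv (rootedSubtree cs 0) e' he'v he'deg (l ∘ Φ)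
    (hle.trans hswap)
  refine ⟨Φ.symm.toEquiv.trans k, fun x => ?_, ?_⟩
  · rw [← hdeg]
    exact (hk _).trans (deg_iso Φ.symm x)
  · refine (hsum.trans (le_of_eq ?_)).trans hksum
    rw [edgeSum_iso Φ]
    simp only [weight_map]

theorem dominates_of_algorithmTwo : ∀ D : List ℕ, D ≠ [] → D.Pairwise (· ≥ ·) →
    (∀ c ∈ D, 2 ≤ c) → ∀ T, AlgorithmTwo (algorithmOne D) T → Dominates D T := by
  refine algorithmOne_induction (fun D d hsort h2 hle T hT => ?_)
    (fun D d hsort h2 hlt ih T hT => ?_)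
  · rw [algorithmOne_concat_of_le hle] at hT
    rw [hT.eq_of_singleton]
    exact dominates_rootedSubtree hsort h2 hle
  · rw [algorithmOne_concat_of_lt hlt] at hT
    obtain ⟨T', v, hT', hv, rfl⟩ := hT.exists_of_cons (algorithmOne_ne_nil _)
    obtain ⟨htree, hmult⟩ := algorithmTwo_isTree_degreeMultiset (D.drop (d - 1))
      (by rw [ne_eq, List.drop_eq_nil_iff]; omega)
      ((List.pairwise_append.1 hsort).1.sublist (List.drop_sublist _ _))
      (fun c hc => h2 c (List.mem_append_left _ (List.mem_of_mem_drop hc))) T' hT'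
    exact dominates_merge hsort h2 hlt htree hmult hv (ih T' hT')

end SomborTrees

theorem mainTheorem3 (D : List ℕ) (hne : D ≠ []) (hsorted : D.Pairwise (· ≥ ·))
    (hD : ∀ d ∈ D, 2 ≤ d) :
    (∃ T : SomborTrees.FiniteGraph, SomborTrees.AlgorithmTwo (SomborTrees.algorithmOne D) T) ∧
    ∀ T : SomborTrees.FiniteGraph, SomborTrees.AlgorithmTwo (SomborTrees.algorithmOne D) T →
      SomborTrees.IsMaximumOptimalTree D T.graph := by
  refine ⟨SomborTrees.exists_algorithmTwo D hne hsorted hD, fun T hT => ?_⟩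
  obtain ⟨htree, hmult⟩ :=
    SomborTrees.algorithmTwo_isTree_degreeMultiset D hne hsorted hD T hT
  refine ⟨htree, (SomborTrees.degreeSequence_eq_iff _ hsorted).2 hmult, fun W _ H hH hHD => ?_⟩
  have hHmult := (SomborTrees.degreeSequence_eq_iff H hsorted).1 hHD
  -- The degree is itself a labelling, since leaves get 1 and all entries are at least 2.
  obtain ⟨e, he, hle⟩ := SomborTrees.dominates_of_algorithmTwo D hne hsorted hD T hT W H hH hHmult
    (SomborTrees.deg H) ⟨fun _ _ => rfl, fun v hv c hc => by have := hD c hc; omega⟩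
  rw [SomborTrees.sombor_eq_edgeSum, SomborTrees.sombor_eq_edgeSum]
  have hlabel : SomborTrees.deg H ∘ e.symm = SomborTrees.deg T.graph := by
    ext t
    rw [Function.comp_apply, ← he, e.apply_symm_apply]
  rwa [hlabel] at hle
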